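/- Let $c,E\in\mathbb R$ lie in one of the four regions $|c|<1,\ E<0$; $|c|<1,\ 0<E<2$; $|c|>1,\ 0<E<2$; $|c|>1,\ E>2$. Put $(k^2,\lambda^2)=\left(\frac{2}{2-E},\frac{2-E}{2(1-c^2)}\right)$, $\left(\frac{2-E}{2},\frac1{1-c^2}\right)$, $\left(\frac E2,\frac1{c^2-1}\right)$, $\left(\frac2E,\frac{E}{2(c^2-1)}\right)$ respectively, with $k,\lambda>0$, let $\mathcal K(k)=\int_0^{\pi/2}(1-k^2\sin^2y)^{-1/2}\,dy$, $\omega_1=\mathcal K(k)/\lambda$, $\omega_3=i\,\mathcal K(\sqrt{1-k^2})/\lambda$, and let $\wp$, $\zeta_w$ be the Weierstrass $\wp$ and zeta functions of the lattice $2\omega_1\mathbb Z+2\omega_3\mathbb Z$. For $\zeta\neq0$ let $\Omega=\Omega(\zeta)$ denote either square root of $$\Omega^2=\tfrac1{64}\Big(-8(c^2-1)(E-1)-\tfrac{(c-1)^2}{\zeta^2}-16(c+1)^2\zeta^2\Big),$$ let $C_4=\frac83\zeta\big((c-1)(E-1)+12(c+1)\zeta^2-24i\zeta\Omega\big)$,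 $C_5=16(c-1)^2(c+1)\zeta$, let $\rho$ be any point off the lattice with $\wp(\rho)=-C_4/C_5$, and let $$I(\zeta)=\frac{2\omega_1(i\zeta+\Omega)}{c-1}+2\nu\big(\zeta_w(\rho)\omega_1-\zeta_w(\omega_1)\rho\big),$$ where $\nu=1$ if $-\frac\pi2<\arg\frac{\zeta(-i(c-1)(E-1)-4i(c+1)\zeta^2-8\zeta\Omega)}{(c-1)^3(c+1)}\le\frac\pi2$ and $\nu=-1$ otherwise ($\arg$ is the principal argument). Let $f:\mathbb R\to\mathbb R$ be a $C^2$ function with $(c^2-1)f''+\sin f=0$ and $\frac12(c^2-1)f'^2+1-\cos f=E$. Let $\sigma_L$ be the set of $\zeta\in\mathbb C\setminus\{0\}$ for which the system $$\chi_1'=C\chi_1+D\chi_2,\quad \chi_2'=\tilde D\chi_1-C\chi_2,\qquad C=-\tfrac{i\zeta}{2}+\tfrac{i\cos f}{8\zeta},\quad D=\tfrac{i\sin f}{8\zeta}-\tfrac{(1-c)f'}{4},\quad \tilde D=\tfrac{i\sin f}{8\zeta}+\tfrac{(1-c)f'}{4},$$ has a nontrivial solution bounded on $\mathbb R$, and let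 $\sigma_{\mathcal L}$ be the set of $\mu\in\mathbb C$ for which $$\mu W_1=W_2,\qquad \mu W_2=-(c^2-1)W_1''-\cos(f)\,W_1+2cW_2'$$ has a nontrivial solution with $W_1\in C^2$, $W_2\in C^1$ bounded on $\mathbb R$. **Theorem.** (1) Let $\zeta\in\mathbb R\setminus\{0\}$ and let $\Omega$ be either value of $\Omega(\zeta)$. Then $\Omega\in i\mathbb R$; points $\rho$ as above exist; and $\operatorname{Re} I(\zeta)=0$ for every choice of $\rho$. If moreover $(c+1)\,\zeta\,\operatorname{Im}\Omega>0$, then $\rho$ can be chosen purely imaginary with $\zeta_w(\rho)$ purely imaginary. (2) Let $\lambda_1=i\sqrt{(1-c^2)(2-E)/2}$ if $|c|<1$ and $\lambda_1=i\sqrt{E(c^2-1)/2}$ if $|c|>1$. The set of all values $2\Omega(\zeta)$, $\zeta\in\mathbb R\setminus\{0\}$, equals $(-i\infty,-\lambda_1]\cup[\lambda_1,i\infty)$. (3) For every such $f$: $\mathbb R\setminus\{0\}\subset\sigma_L$; $2\Omega\in\sigma_{\mathcal L}$ for every $\zeta\in\mathbb R\setminus\{0\}$ and either value $\Omega$ of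 $\Omega(\zeta)$; hence $(-i\infty,-\lambda_1]\cup[\lambda_1,i\infty)\subset\sigma_{\mathcal L}$. -/

import Mathlib

namespace SineGordon

noncomputable section

/-! ### Parameters, elliptic integrals and the period lattice -/

/-- Wave speed `c` and energy `E` lie in one of the four open regions: subluminal rotational,
subluminal librational, superluminal librational, superluminal rotational. -/
def Admissible (c E : ℝ) : Prop :=
  (|c| < 1 ∧ (E < 0 ∨ (0 < E ∧ E < 2))) ∨ (1 < |c| ∧ ((0 < E ∧ E < 2) ∨ 2 < E))

/-- The elliptic modulus `k` in the four regions. -/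
def modulus (c E : ℝ) : ℝ :=
  if |c| < 1 then
    if E < 0 then √(2 / (2 - E)) else √((2 - E) / 2)
  else
    if 2 < E then √(2 / E) else √(E / 2)

/-- The scaling `λ` of the elliptic solution `cos f = α + β sn² (λ z, k)` in the four regions. -/
def scale (c E : ℝ) : ℝ :=
  if |c| < 1 then
    if E < 0 then √((2 - E) / (2 * (1 - c ^ 2))) else √(1 / (1 - c ^ 2))
  else
    if 2 < E then √(E / (2 * (c ^ 2 - 1))) else √(1 / (c ^ 2 - 1))

/-- The complete elliptic integral of the first kind, as a function of the modulus. -/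
def ellipticK (k : ℝ) : ℝ := ∫ y in (0 : ℝ)..(Real.pi / 2), 1 / √(1 - k ^ 2 * Real.sin y ^ 2)

/-- The half-period `ω₁ = K(k) / λ`. -/
def omega1 (c E : ℝ) : ℝ := ellipticK (modulus c E) / scale c E

/-- The positive number `ω₃ / i = K'(k) / λ`, with `K'(k) = K(√(1 - k²))`. -/
def omega3Im (c E : ℝ) : ℝ := ellipticK √(1 - modulus c E ^ 2) / scale c E

theorem ellipticK_pos {k : ℝ} (hk : k ^ 2 < 1) : 0 < ellipticK k := by
  have key : ∀ y : ℝ, 0 < 1 - k ^ 2 * Real.sin y ^ 2 := fun y => by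
    nlinarith [Real.sin_sq_le_one y, sq_nonneg (Real.sin y), sq_nonneg k]
  refine intervalIntegral.intervalIntegral_pos_of_pos_on ?_ ?_ (by positivity)
  · refine Continuous.intervalIntegrable ?_ _ _
    refine Continuous.div continuous_const (by fun_prop) fun y => ?_
    exact (Real.sqrt_pos.2 (key y)).ne'
  · intro y _
    exact div_pos one_pos (Real.sqrt_pos.2 (key y))

theorem Admissible.modulus_sq {c E : ℝ} (h : Admissible c E) :
    0 < modulus c E ^ 2 ∧ modulus c E ^ 2 < 1 := by
  have aux : ∀ a b : ℝ, 0 < a → a < b → 0 < √(a / b) ^ 2 ∧ √(a / b) ^ 2 < 1 := by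
    intro a b ha hab
    have hb : 0 < b := ha.trans hab
    rw [Real.sq_sqrt (by positivity)]
    exact ⟨by positivity, (div_lt_one hb).2 hab⟩
  rcases h with ⟨hc, hE | hE⟩ | ⟨hc, hE | hE⟩
  · rw [modulus, if_pos hc, if_pos hE]
    exact aux _ _ (by norm_num) (by linarith)
  · rw [modulus, if_pos hc, if_neg (not_lt.2 hE.1.le)]
    exact aux _ _ (by linarith) (by linarith)
  · rw [modulus, if_neg (not_lt.2 hc.le), if_neg (not_lt.2 hE.2.le)]
    exact aux _ _ (by linarith) (by linarith)
  · rw [modulus, if_neg (not_lt.2 hc.le), if_pos hE]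
    exact aux _ _ (by linarith) (by linarith)

theorem Admissible.scale_pos {c E : ℝ} (h : Admissible c E) : 0 < scale c E := by
  rcases h with ⟨hc, hE⟩ | ⟨hc, hE⟩
  · have h1 : 0 < 1 - c ^ 2 := by linarith [(sq_lt_one_iff_abs_lt_one c).2 hc]
    rw [scale, if_pos hc]
    split_ifs with h2
    · have : 0 < 2 - E := by linarith
      exact Real.sqrt_pos.2 (by positivity)
    · exact Real.sqrt_pos.2 (by positivity)
  · have h1 : 0 < c ^ 2 - 1 := by linarith [(one_lt_sq_iff_one_lt_abs c).2 hc]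
    rw [scale, if_neg (not_lt.2 hc.le)]
    split_ifs with h2
    · have : 0 < E := by linarith
      exact Real.sqrt_pos.2 (by positivity)
    · exact Real.sqrt_pos.2 (by positivity)

theorem Admissible.omega1_pos {c E : ℝ} (h : Admissible c E) : 0 < omega1 c E :=
  div_pos (ellipticK_pos h.modulus_sq.2) h.scale_pos

theorem Admissible.omega3Im_pos {c E : ℝ} (h : Admissible c E) : 0 < omega3Im c E := by
  refine div_pos (ellipticK_pos ?_) h.scale_pos
  rw [Real.sq_sqrt (by linarith [h.modulus_sq.2])]
  linarith [h.modulus_sq.1]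

/-- The periods `2 ω₁` and `2 ω₃` of the Weierstrass functions. -/
def waveLattice {c E : ℝ} (h : Admissible c E) : PeriodPair where
  ω₁ := ((2 * omega1 c E : ℝ) : ℂ)
  ω₂ := ((2 * omega3Im c E : ℝ) : ℂ) * Complex.I
  indep := by
    rw [LinearIndependent.pair_iff]
    intro s t hst
    have hre := congrArg Complex.re hst
    have him := congrArg Complex.im hst
    simp at hre him
    exact ⟨hre.resolve_right h.omega1_pos.ne', him.resolve_right h.omega3Im_pos.ne'⟩

/-- The Weierstrass zeta function `1/z + ∑_{l ≠ 0} (1/(z - l) + 1/l + z/l²)` of a lattice.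
The convention `1 / 0 = 0` makes the summand at `l = 0` equal to `1/z`. -/
def weierstrassZeta (L : PeriodPair) (z : ℂ) : ℂ :=
  ∑' l : L.lattice, (1 / (z - l) + 1 / (l : ℂ) + z / (l : ℂ) ^ 2)

/-! ### The condition on the Lax parameter -/

/-- `Ω(ζ)²` as a function of `ζ`. -/
def omegaSq (c E : ℝ) (ζ : ℂ) : ℂ :=
  (-8 * (c ^ 2 - 1) * (E - 1) - (c - 1) ^ 2 / ζ ^ 2 - 16 * (c + 1) ^ 2 * ζ ^ 2) / 64

def C4 (c E : ℝ) (ζ Ω : ℂ) : ℂ :=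
  8 / 3 * ζ * ((c - 1) * (E - 1) + 12 * (c + 1) * ζ ^ 2 - 24 * Complex.I * ζ * Ω)

def C5 (c : ℝ) (ζ : ℂ) : ℂ := 16 * (c - 1) ^ 2 * (c + 1) * ζ

/-- `ρ` is a value of the multivalued `℘⁻¹(-C₄/C₅)`. -/
def IsRho {c E : ℝ} (h : Admissible c E) (ζ Ω ρ : ℂ) : Prop :=
  ρ ∉ (waveLattice h).lattice ∧
    (waveLattice h).weierstrassP ρ = -C4 c E ζ Ω / C5 c ζ

open Classical in
/-- The sign `ν`. -/
def nu (c E : ℝ) (ζ Ω : ℂ) : ℂ :=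
  let N : ℂ := ζ * (-Complex.I * (c - 1) * (E - 1) - 4 * Complex.I * (c + 1) * ζ ^ 2 - 8 * ζ * Ω)
    / ((c - 1) ^ 3 * (c + 1))
  if -(Real.pi / 2) < N.arg ∧ N.arg ≤ Real.pi / 2 then 1 else -1

/-- The quantity `I(ζ)`, for the chosen values `Ω` of `Ω(ζ)` and `ρ` of `ρ(ζ)`. -/
def laxI {c E : ℝ} (h : Admissible c E) (ζ Ω ρ : ℂ) : ℂ :=
  2 * omega1 c E * (Complex.I * ζ + Ω) / (c - 1) +
    2 * nu c E ζ Ω *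
      (weierstrassZeta (waveLattice h) ρ * omega1 c E -
        weierstrassZeta (waveLattice h) (omega1 c E) * ρ)

/-! ### Waves, Lax spectrum and stability spectrum -/

/-- `f` is the profile of a stationary wave with speed `c` and energy `E`. -/
structure IsWave (c E : ℝ) (f : ℝ → ℝ) : Prop where
  contDiff : ContDiff ℝ 2 f
  pendulum : ∀ z, (c ^ 2 - 1) * deriv (deriv f) z + Real.sin (f z) = 0
  energy : ∀ z, 1 / 2 * (c ^ 2 - 1) * deriv f z ^ 2 + 1 - Real.cos (f z) = E

def laxC (f : ℝ → ℝ) (ζ : ℂ) (z : ℝ) : ℂ :=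
  -(Complex.I * ζ / 2) + Complex.I * Real.cos (f z) / (8 * ζ)

def laxD (c : ℝ) (f : ℝ → ℝ) (ζ : ℂ) (z : ℝ) : ℂ :=
  Complex.I * Real.sin (f z) / (8 * ζ) - deriv f z / 4 + c * deriv f z / 4

/-- The lower left entry of the `z`-part of the Lax pair; it is `-conj D` for real `ζ`. -/
def laxD' (c : ℝ) (f : ℝ → ℝ) (ζ : ℂ) (z : ℝ) : ℂ :=
  Complex.I * Real.sin (f z) / (8 * ζ) + deriv f z / 4 - c * deriv f z / 4

/-- The Lax spectrum: those `ζ` for which the `z`-part of the Lax pair has a nontrivial solution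
that is bounded on the real line. -/
def laxSpectrum (c : ℝ) (f : ℝ → ℝ) : Set ℂ :=
  {ζ | ζ ≠ 0 ∧ ∃ χ₁ χ₂ : ℝ → ℂ,
    (∀ z, HasDerivAt χ₁ (laxC f ζ z * χ₁ z + laxD c f ζ z * χ₂ z) z) ∧
    (∀ z, HasDerivAt χ₂ (laxD' c f ζ z * χ₁ z - laxC f ζ z * χ₂ z) z) ∧
    (∃ z, χ₁ z ≠ 0 ∨ χ₂ z ≠ 0) ∧
    ∃ M : ℝ, ∀ z, ‖χ₁ z‖ ≤ M ∧ ‖χ₂ z‖ ≤ M}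

/-- The stability spectrum: those `μ` for which `μ W = 𝓛 W` has a nontrivial solution
`W = (W₁, W₂)` that is bounded on the real line. -/
def stabilitySpectrum (c : ℝ) (f : ℝ → ℝ) : Set ℂ :=
  {μ | ∃ W₁ W₂ : ℝ → ℂ, ContDiff ℝ 2 W₁ ∧ ContDiff ℝ 1 W₂ ∧
    (∀ z, μ * W₁ z = W₂ z) ∧
    (∀ z, μ * W₂ z =
      -(c ^ 2 - 1) * deriv (deriv W₁) z - Real.cos (f z) * W₁ z + 2 * c * deriv W₂ z) ∧
    (∃ z, W₁ z ≠ 0 ∨ W₂ z ≠ 0) ∧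
    ∃ M : ℝ, ∀ z, ‖W₁ z‖ ≤ M ∧ ‖W₂ z‖ ≤ M}

/-- The number `λ₁ / i`. -/
def lambdaOneIm (c E : ℝ) : ℝ :=
  if |c| < 1 then √((1 - c ^ 2) * (2 - E) / 2) else √(E * (c ^ 2 - 1) / 2)

/-- The set `(-i∞, -λ₁] ∪ [λ₁, i∞)`. -/
def imaginaryRays (c E : ℝ) : Set ℂ :=
  {μ | ∃ t : ℝ, (t ≤ -lambdaOneIm c E ∨ lambdaOneIm c E ≤ t) ∧ μ = t * Complex.I}

end

end SineGordon

/-! Write d = c² - 1. For real ζ the inequality between arithmetic and geometric means gives -4Ω² ≥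
|λ₁|² > 0 (`lambdaOneIm_sq_le`), so Ω = iw with w real, and P = -C₄/C₅ is real. Inserting P into the
cubic (x - e₁)(x - e₂)(x - e₃) of the lattice gives minus a square (`rhoValue_cubic`), so ℘(ρ) is
real and ℘'(ρ) imaginary. Since ℘ and ℘' together determine a point modulo the lattice
(`sub_mem_lattice_of_eq`), the conjugate of ρ is congruent to -ρ. Hence Re ρ = mω₁ with m an
integer, and quasi-periodicity of the zeta function cancels the real part of ζ_w(ρ)ω₁ - ζ_w(ω₁)ρ.
Existence of ρ, and its position on the imaginary axis, follow from the intermediate value theorem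
once P is compared with e₃ < e₂ < e₁.

The lattice is given by elliptic integrals, so its eᵢ have to be recovered from its periods.
Integrating ℘'² = 4(℘ - e₁)(℘ - e₂)(℘ - e₃) along the real and imaginary half periods expresses both
as complete elliptic integrals (`sqrt_mul_eq_ellipticK`), and monotonicity of K shows that these two
numbers determine the modulus and the scale (`eq_of_ellipticK_eq`).

For the second part, the equation 2Ω = it is a quadratic in ζ² whose discriminant is nonnegative
exactly when it should be.

For the third part, real ζ make the Lax system skew-hermitian, so |χ₁|² + |χ₂|² is conserved. The
stability spectrum is reached without squared eigenfunctions: an exponential factor of modulus one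
turns the spectral problem at it into the Lamé equation dV'' + (cos f + τ)V = 0 with τ = t²/d.
Inside the band it has the bounded solution √G exp(i∫m/G) with G = ±(cos f + E - 1 - 2τ)
(`lame_of_pos`); at the band edge sin(f/2) or cos(f/2) is a solution. -/

namespace PeriodPair

/-! ### The ℘-function: differential equation, fibres and critical points. -/

open Filter Topology

variable (L : PeriodPair)

lemma countable_lattice : (L.lattice : Set ℂ).Countable := by
  have : Countable L.lattice := L.latticeEquivProd.toEquiv.countable_iff.2 inferInstance
  exact Set.to_countable _

lemma isPreconnected_compl_of_countable {s : Set ℂ} (hs : s.Countable) :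
    IsPreconnected sᶜ :=
  (hs.isConnected_compl_of_one_lt_rank (by simp)).isPreconnected

lemma hasDerivAt_weierstrassP {z : ℂ} (hz : z ∉ L.lattice) :
    HasDerivAt L.weierstrassP (L.derivWeierstrassP z) z := by
  have h := ((L.analyticOnNhd_weierstrassP z hz).differentiableAt).hasDerivAt
  rwa [L.deriv_weierstrassP] at h

/-- The second order differential equation `℘'' = 6 ℘² - g₂ / 2`. -/
lemma hasDerivAt_derivWeierstrassP {z : ℂ} (hz : z ∉ L.lattice) :
    HasDerivAt L.derivWeierstrassP (6 * L.weierstrassP z ^ 2 - L.g₂ / 2) z := by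
  have hopen : IsOpen (L.lattice : Set ℂ)ᶜ := L.isClosed_lattice.isOpen_compl
  have hP := L.analyticOnNhd_weierstrassP
  have hP' := L.analyticOnNhd_derivWeierstrassP
  have hpre := isPreconnected_compl_of_countable L.countable_lattice
  -- Differentiating ℘'² = 4℘³ - g₂℘ - g₃ gives the desired equation times ℘'. On the connected
  -- complement of the lattice one analytic factor must vanish identically; it is not ℘', because ℘
  -- has a pole at 0 and so is not constant.
  have hprod : ∀ w ∈ (L.lattice : Set ℂ)ᶜ, (fun w => (2 * deriv L.derivWeierstrassP w -
      12 * L.weierstrassP w ^ 2 + L.g₂)) w * L.derivWeierstrassP w = 0 := by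
    intro w hw
    have h1 : HasDerivAt (fun w => L.derivWeierstrassP w ^ 2) _ w :=
      (hP' w hw).differentiableAt.hasDerivAt.pow 2
    have h2 : HasDerivAt (fun w => 4 * L.weierstrassP w ^ 3 - L.g₂ * L.weierstrassP w - L.g₃) _ w :=
      ((((L.hasDerivAt_weierstrassP hw).pow 3).const_mul 4).sub
        ((L.hasDerivAt_weierstrassP hw).const_mul L.g₂)).sub_const _
    have h3 : (fun w => L.derivWeierstrassP w ^ 2) =ᶠ[𝓝 w]
        (fun w => 4 * L.weierstrassP w ^ 3 - L.g₂ * L.weierstrassP w - L.g₃) := by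
      filter_upwards [hopen.mem_nhds hw] with u hu using L.derivWeierstrassP_sq u hu
    have h4 := h1.unique (h2.congr_of_eventuallyEq h3)
    simp only [Nat.cast_ofNat, Nat.add_one_sub_one, pow_one] at h4
    linear_combination h4
  have hana : AnalyticOnNhd ℂ (fun w => (2 * deriv L.derivWeierstrassP w -
      12 * L.weierstrassP w ^ 2 + L.g₂)) (L.lattice : Set ℂ)ᶜ := by
    intro w hw
    have := (hP' w hw).deriv
    have := hP w hw
    fun_prop
  rcases hana.eq_zero_or_eq_zero_of_mul_eq_zero hP' hprod hpre with h | h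
  · have h5 := (hP' z hz).differentiableAt.hasDerivAt
    have h6 : 2 * deriv L.derivWeierstrassP z - 12 * L.weierstrassP z ^ 2 + L.g₂ = 0 := h z hz
    rwa [show deriv L.derivWeierstrassP z = 6 * L.weierstrassP z ^ 2 - L.g₂ / 2 by
      linear_combination h6 / 2] at h5
  · exfalso
    obtain ⟨C, hC⟩ := hopen.exists_is_const_of_deriv_eq_zero hpre L.differentiableOn_weierstrassP
      (fun w hw => by simpa using h w hw)
    have h7 := L.order_weierstrassP 0 (zero_mem _)
    have h8 : L.weierstrassP =ᶠ[𝓝[≠] 0] fun _ => C := by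
      filter_upwards [self_mem_nhdsWithin, mem_nhdsWithin_of_mem_nhds
        (L.compl_lattice_sdiff_singleton_mem_nhds 0)] with w hw hw'
      exact hC w (fun hl => hw' ⟨hl, hw⟩)
    rw [meromorphicOrderAt_congr h8] at h7
    have h9 := (analyticAt_const (𝕜 := ℂ) (v := C) (x := (0 : ℂ))).meromorphicOrderAt_nonneg
    rw [h7] at h9
    exact absurd h9 (by decide)

/-- A solution of the analytic equation `d'' = u d` with `d` and `d'` vanishing at a point is
locally zero. -/
lemma eventually_eq_zero_of_deriv_deriv_eq_mul {d u : ℂ → ℂ} {x : ℂ} (hd : AnalyticAt ℂ d x)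
    (hu : AnalyticAt ℂ u x) (h0 : d x = 0) (h1 : deriv d x = 0)
    (h : deriv (deriv d) =ᶠ[𝓝 x] u * d) : d =ᶠ[𝓝 x] 0 := by
  -- Orders of vanishing: two differentiations lower a finite order of d by exactly 2, while
  -- multiplication by u cannot lower it.
  have e1 := hd.analyticOrderAt_deriv_add_one
  have e2 := hd.deriv.analyticOrderAt_deriv_add_one
  simp only [h0, h1, sub_zero] at e1 e2
  rw [analyticOrderAt_congr h, analyticOrderAt_mul hu hd] at e2
  by_contra hne
  have hfin : analyticOrderAt d x ≠ ⊤ := by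
    rwa [Ne, analyticOrderAt_eq_top]
  have : analyticOrderAt (fun z => d z) x = analyticOrderAt d x := rfl
  have : analyticOrderAt (fun z => deriv d z) x = analyticOrderAt (deriv d) x := rfl
  have h3 : analyticOrderAt d x + 2 ≤ analyticOrderAt d x := by
    calc analyticOrderAt d x + 2 ≤ (analyticOrderAt u x + analyticOrderAt d x) + 1 + 1 := by
          rw [add_assoc _ 1 1, one_add_one_eq_two]
          gcongr
          exact le_add_self
      _ = analyticOrderAt d x := by simp_all
  obtain ⟨n, hn⟩ := ENat.ne_top_iff_exists.1 hfin
  rw [← hn] at h3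
  norm_cast at h3
  omega

/-- With c = a - b, the function d(w) = ℘(w + c) - ℘(w) satisfies d'' = 6(℘(w + c) + ℘(w))d and has
zero Cauchy data at b. It therefore vanishes off a countable set, and the pole of ℘ at 0 forces a
pole at c. -/
lemma sub_mem_lattice_of_eq {a b : ℂ} (ha : a ∉ L.lattice) (hb : b ∉ L.lattice)
    (h : L.weierstrassP a = L.weierstrassP b)
    (h' : L.derivWeierstrassP a = L.derivWeierstrassP b) : a - b ∈ L.lattice := by
  set c := a - b with hc
  by_contra hcL
  have hopen : IsOpen (L.lattice : Set ℂ)ᶜ := L.isClosed_lattice.isOpen_compl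
  set s : Set ℂ := L.lattice ∪ (fun l => l - c) '' L.lattice with hs
  have hsc : s.Countable := L.countable_lattice.union (L.countable_lattice.image _)
  have hms : ∀ w, w ∈ sᶜ → w ∉ L.lattice ∧ w + c ∉ L.lattice := fun w hw =>
    ⟨fun hl => hw (Or.inl hl), fun hl => hw (Or.inr ⟨w + c, hl, by simp⟩)⟩
  have hbs : b ∈ sᶜ := by
    rintro (hl | ⟨l, hl, hl'⟩)
    · exact hb hl
    · apply ha
      have : a = l := by simp only [hc] at hl'; linear_combination -hl'
      rwa [this]
  set d : ℂ → ℂ := fun w => L.weierstrassP (w + c) - L.weierstrassP w with hd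
  set u : ℂ → ℂ := fun w => 6 * (L.weierstrassP (w + c) + L.weierstrassP w) with hu
  have hPc : ∀ w, w + c ∉ L.lattice → AnalyticAt ℂ (fun w => L.weierstrassP (w + c)) w :=
    fun w hw => (L.analyticOnNhd_weierstrassP _ hw).comp_of_eq
      (g := L.weierstrassP) (f := fun w => w + c) (by fun_prop) rfl
  have hdana : AnalyticOnNhd ℂ d sᶜ := fun w hw =>
    (hPc w (hms w hw).2).sub (L.analyticOnNhd_weierstrassP _ (hms w hw).1)
  have huana : AnalyticAt ℂ u b :=
    analyticAt_const.mul
      ((hPc b (hms b hbs).2).add (L.analyticOnNhd_weierstrassP _ (hms b hbs).1))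
  have hbc : b + c = a := by simp [hc]
  have hnear : ∀ᶠ w in 𝓝 b, w ∉ L.lattice ∧ w + c ∉ L.lattice := by
    have h1 : ∀ᶠ w in 𝓝 b, w ∉ L.lattice := hopen.mem_nhds hb
    refine h1.and ?_
    refine (continuous_add_const c).continuousAt.eventually (hopen.mem_nhds ?_)
    simpa [hbc] using ha
  have hderiv : ∀ w, w ∉ L.lattice ∧ w + c ∉ L.lattice → HasDerivAt d
      (L.derivWeierstrassP (w + c) - L.derivWeierstrassP w) w := fun w hw =>
    ((L.hasDerivAt_weierstrassP hw.2).comp_add_const w c).sub (L.hasDerivAt_weierstrassP hw.1)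
  have hderiv2 : deriv (deriv d) =ᶠ[𝓝 b] u * d := by
    have h1 : deriv d =ᶠ[𝓝 b]
        fun w => L.derivWeierstrassP (w + c) - L.derivWeierstrassP w := by
      filter_upwards [hnear] with w hw using (hderiv w hw).deriv
    filter_upwards [hnear, h1.deriv] with w hw hw'
    have h2 := (((L.hasDerivAt_derivWeierstrassP hw.2).comp_add_const w c).sub
      (L.hasDerivAt_derivWeierstrassP hw.1)).deriv
    refine (hw'.trans h2).trans ?_
    simp only [hu, hd, Pi.mul_apply]
    ring
  have hzero : d =ᶠ[𝓝 b] 0 := by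
    refine eventually_eq_zero_of_deriv_deriv_eq_mul (hdana b hbs) huana ?_ ?_ hderiv2
    · simp [hd, hbc, h]
    · rw [(hderiv b (hms b hbs)).deriv, hbc, h', sub_self]
  have hall := hdana.eqOn_zero_of_preconnected_of_eventuallyEq_zero
    (isPreconnected_compl_of_countable hsc) hbs hzero
  have h7 := L.order_weierstrassP 0 (zero_mem _)
  have h8 : L.weierstrassP =ᶠ[𝓝[≠] 0] fun w => L.weierstrassP (w + c) := by
    have h0 : ∀ᶠ w in 𝓝 (0 : ℂ), w + c ∉ L.lattice :=
      (continuous_add_const c).continuousAt.eventually (hopen.mem_nhds (by simpa using hcL))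
    filter_upwards [self_mem_nhdsWithin, mem_nhdsWithin_of_mem_nhds
      (L.compl_lattice_sdiff_singleton_mem_nhds 0), mem_nhdsWithin_of_mem_nhds h0] with w hw hw' hw0
    have hws : w ∈ sᶜ := by
      rintro (hl | ⟨l, hl, hl'⟩)
      · exact hw' ⟨hl, hw⟩
      · apply hw0
        have : w + c = l := by simp only at hl'; linear_combination -hl'
        rwa [this]
    exact (sub_eq_zero.1 (hall hws)).symm
  rw [meromorphicOrderAt_congr h8] at h7
  have h9 := (hPc 0 (by simpa using hcL)).meromorphicOrderAt_nonneg
  rw [h7] at h9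
  exact absurd h9 (by decide)

lemma weierstrassP_eq_weierstrassP {a b : ℂ} (ha : a ∉ L.lattice) (hb : b ∉ L.lattice)
    (h : L.weierstrassP a = L.weierstrassP b) : a - b ∈ L.lattice ∨ a + b ∈ L.lattice := by
  have hsq : L.derivWeierstrassP a ^ 2 = L.derivWeierstrassP b ^ 2 := by
    rw [L.derivWeierstrassP_sq a ha, L.derivWeierstrassP_sq b hb, h]
  rcases sq_eq_sq_iff_eq_or_eq_neg.1 hsq with h' | h'
  · exact Or.inl (L.sub_mem_lattice_of_eq ha hb h h')
  · right
    have := L.sub_mem_lattice_of_eq ha (b := -b) (by simpa using hb) (by simpa using h)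
      (by simpa using h')
    simpa using this

lemma derivWeierstrassP_eq_zero_iff {a : ℂ} (ha : a ∉ L.lattice) :
    L.derivWeierstrassP a = 0 ↔ 2 * a ∈ L.lattice := by
  constructor
  · intro h
    have := L.sub_mem_lattice_of_eq ha (b := -a) (by simpa using ha) (by simp)
      (by simp [h])
    rwa [sub_neg_eq_add, ← two_mul] at this
  · intro h
    have h1 := L.derivWeierstrassP_add_coe (-a) ⟨2 * a, h⟩
    rw [show -a + 2 * a = a by ring, L.derivWeierstrassP_neg] at h1
    linear_combination h1 / 2

end PeriodPair

/-! ### The Weierstrass zeta function: derivative, quasi-periodicity and conjugation. -/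

namespace SineGordon

open Filter Topology

open PeriodPair

variable (L : PeriodPair)

/-- The three terms combine to s²/(l²(s - l)). The resulting decay of order -3 is summable over a
lattice of rank two. -/
lemma weierstrassZeta_bound {r : ℝ} {s l : ℂ} (hr : 0 < r) (hs : ‖s‖ < r) (h : 2 * r ≤ ‖l‖) :
    ‖1 / (s - l) + 1 / l + s / l ^ 2‖ ≤ 2 * r ^ 2 * ‖l‖ ^ (-3 : ℝ) := by
  have hl : 0 < ‖l‖ := by linarith
  have hl0 : l ≠ 0 := norm_pos_iff.1 hl
  have hsl : ‖l‖ / 2 ≤ ‖s - l‖ := by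
    have := norm_sub_norm_le l s
    rw [norm_sub_rev] at this
    linarith
  have hsl0 : s - l ≠ 0 := norm_pos_iff.1 (by linarith)
  have e : 1 / (s - l) + 1 / l + s / l ^ 2 = s ^ 2 / (l ^ 2 * (s - l)) := by
    field_simp
    ring
  rw [e, norm_div, norm_mul, norm_pow, norm_pow]
  calc ‖s‖ ^ 2 / (‖l‖ ^ 2 * ‖s - l‖) ≤ r ^ 2 / (‖l‖ ^ 2 * (‖l‖ / 2)) := by gcongr
    _ = 2 * r ^ 2 * (‖l‖ ^ 3)⁻¹ := by field_simp
    _ = _ := by rw [Real.rpow_neg hl.le]; norm_cast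

lemma hasSumLocallyUniformly_weierstrassZeta :
    HasSumLocallyUniformly
      (fun (l : L.lattice) (z : ℂ) ↦ 1 / (z - l) + 1 / (l : ℂ) + z / (l : ℂ) ^ 2)
      (weierstrassZeta L) := by
  refine L.hasSumLocallyUniformly_aux (u := (2 * · ^ 2 * ‖·‖ ^ (-3 : ℝ))) _
    (fun _ _ ↦ (ZLattice.summable_norm_rpow _ _ (by simp; norm_num)).mul_left _) fun r hr ↦
    eventually_atTop.mpr ⟨2 * r, ?_⟩
  rintro _ h s hs l rfl
  exact weierstrassZeta_bound hr hs h

lemma hasDerivAt_weierstrassZeta {z : ℂ} (hz : z ∉ L.lattice) :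
    HasDerivAt (weierstrassZeta L) (-L.weierstrassP z) z := by
  have hopen : IsOpen (L.lattice : Set ℂ)ᶜ := L.isClosed_lattice.isOpen_compl
  have hterm : ∀ l : L.lattice, ∀ w ∈ (L.lattice : Set ℂ)ᶜ,
      HasDerivAt (fun z : ℂ => 1 / (z - l) + 1 / (l : ℂ) + z / (l : ℂ) ^ 2)
        (-(1 / (w - l) ^ 2 - 1 / (l : ℂ) ^ 2)) w := by
    intro l w hw
    have hwl : w - l ≠ 0 := fun e => hw (by rw [sub_eq_zero.1 e]; exact l.2)
    have h1 := (((hasDerivAt_id w).sub_const (l : ℂ)).inv hwl).add_const (1 / (l : ℂ))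
    have h2 := h1.add ((hasDerivAt_id w).div_const ((l : ℂ) ^ 2))
    have h3 : (fun z : ℂ => 1 / (z - l) + 1 / (l : ℂ) + z / (l : ℂ) ^ 2) =
        (fun x => (id x - (l : ℂ))⁻¹ + 1 / (l : ℂ)) + fun x => id x / (l : ℂ) ^ 2 := by
      ext z; simp
    rw [h3]
    convert! h2 using 1
    simp only [id]
    ring
  have hloc := (hasSumLocallyUniformly_weierstrassZeta L).tendstoLocallyUniformlyOn
    (s := (L.lattice : Set ℂ)ᶜ)
  have hdiff : ∀ s : Finset L.lattice, ∀ w ∈ (L.lattice : Set ℂ)ᶜ,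
      HasDerivAt (fun z => ∑ l ∈ s, (1 / (z - l) + 1 / (l : ℂ) + z / (l : ℂ) ^ 2))
        (∑ l ∈ s, -(1 / (w - l) ^ 2 - 1 / (l : ℂ) ^ 2)) w := fun s w hw =>
    HasDerivAt.fun_sum fun l _ => hterm l w hw
  have hd : DifferentiableOn ℂ (weierstrassZeta L) (L.lattice : Set ℂ)ᶜ :=
    hloc.differentiableOn (.of_forall fun s w hw =>
      (hdiff s w hw).differentiableAt.differentiableWithinAt) hopen
  have hderiv := (hloc.deriv (.of_forall fun s w hw =>
      (hdiff s w hw).differentiableAt.differentiableWithinAt) hopen).tendsto_at hz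
  have hlim : Tendsto (fun s : Finset L.lattice => ∑ l ∈ s, -(1 / (z - l) ^ 2 - 1 / (l : ℂ) ^ 2))
      atTop (𝓝 (-L.weierstrassP z)) := (L.hasSum_weierstrassP z).neg
  have heq : deriv (weierstrassZeta L) z = -L.weierstrassP z := by
    refine tendsto_nhds_unique hderiv (hlim.congr fun s => ?_)
    exact (hdiff s z hz).deriv.symm
  rw [← heq]
  exact (hd.differentiableAt (hopen.mem_nhds hz)).hasDerivAt

lemma weierstrassZeta_neg (z : ℂ) : weierstrassZeta L (-z) = -weierstrassZeta L z := by
  simp only [weierstrassZeta]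
  rw [← (Equiv.neg L.lattice).tsum_eq, ← tsum_neg]
  congr with l
  simp only [Equiv.neg_apply, NegMemClass.coe_neg]
  rw [show -z - -(l : ℂ) = -(z - l) by ring]
  simp only [div_neg, neg_sq, neg_div]
  ring

/-- The increment over a period has derivative -℘(w + l) + ℘(w) = 0 on a connected set. -/
lemma weierstrassZeta_add_sub (l : L.lattice) {a b : ℂ} (ha : a ∉ L.lattice) (hb : b ∉ L.lattice) :
    weierstrassZeta L (a + l) - weierstrassZeta L a =
      weierstrassZeta L (b + l) - weierstrassZeta L b := by
  have hopen : IsOpen (L.lattice : Set ℂ)ᶜ := L.isClosed_lattice.isOpen_compl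
  have hderiv : ∀ w ∈ (L.lattice : Set ℂ)ᶜ, HasDerivAt
      (fun w => weierstrassZeta L (w + l) - weierstrassZeta L w) 0 w := by
    intro w hw
    have hwl : w + l ∉ L.lattice := fun e => hw (by simpa using L.lattice.sub_mem e l.2)
    have := ((hasDerivAt_weierstrassZeta L hwl).comp_add_const w l).sub
      (hasDerivAt_weierstrassZeta L hw)
    rwa [L.weierstrassP_add_coe, sub_self] at this
  exact hopen.is_const_of_deriv_eq_zero (isPreconnected_compl_of_countable L.countable_lattice)
    (fun w hw => (hderiv w hw).differentiableAt.differentiableWithinAt)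
    (fun w hw => (hderiv w hw).deriv) ha hb

/-- Quasi-periodicity of the zeta function: the increment over a period is twice the value at the
half period. -/
lemma weierstrassZeta_add {w : ℂ} (hw : w ∉ L.lattice) (hw2 : 2 * w ∈ L.lattice) {z : ℂ}
    (hz : z ∉ L.lattice) :
    weierstrassZeta L (z + 2 * w) = weierstrassZeta L z + 2 * weierstrassZeta L w := by
  have h := weierstrassZeta_add_sub L ⟨2 * w, hw2⟩ hz (b := -w) (by simpa using hw)
  simp only [weierstrassZeta_neg, show -w + 2 * w = w by ring] at h
  linear_combination h

section Conj

open ComplexConjugate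

variable {L}

/-- Complex conjugation of a lattice that is stable under it. -/
def conjLattice (hL : ∀ l ∈ L.lattice, conj l ∈ L.lattice) : L.lattice ≃ L.lattice where
  toFun l := ⟨conj l.1, hL _ l.2⟩
  invFun l := ⟨conj l.1, hL _ l.2⟩
  left_inv l := by simp
  right_inv l := by simp

lemma weierstrassP_conj (hL : ∀ l ∈ L.lattice, conj l ∈ L.lattice) (z : ℂ) :
    L.weierstrassP (conj z) = conj (L.weierstrassP z) := by
  simp only [weierstrassP, Complex.conj_tsum]
  rw [← (conjLattice hL).tsum_eq]
  congr with l
  simp [conjLattice]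

lemma derivWeierstrassP_conj (hL : ∀ l ∈ L.lattice, conj l ∈ L.lattice) (z : ℂ) :
    L.derivWeierstrassP (conj z) = conj (L.derivWeierstrassP z) := by
  simp only [derivWeierstrassP, map_neg, Complex.conj_tsum]
  rw [← (conjLattice hL).tsum_eq]
  congr with l
  simp [conjLattice, map_ofNat]

lemma weierstrassZeta_conj (hL : ∀ l ∈ L.lattice, conj l ∈ L.lattice) (z : ℂ) :
    weierstrassZeta L (conj z) = conj (weierstrassZeta L z) := by
  simp only [weierstrassZeta, Complex.conj_tsum]
  rw [← (conjLattice hL).tsum_eq]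
  congr with l
  simp [conjLattice]

end Conj

end SineGordon

/-! ### Rectangular lattices and the values of ℘ at the half periods. -/

namespace SineGordon

open Filter Topology

open PeriodPair Complex ComplexConjugate

/-- The periods are `2 a` and `2 b i` with `a, b > 0`. -/
structure IsRectangular (L : PeriodPair) (a b : ℝ) : Prop where
  a_pos : 0 < a
  b_pos : 0 < b
  ω₁_eq : L.ω₁ = ((2 * a : ℝ) : ℂ)
  ω₂_eq : L.ω₂ = ((2 * b : ℝ) : ℂ) * I

lemma ne_two_mul_int_mul {a x : ℝ} (ha : 0 < a) (h0 : 0 < x) (h1 : x < 2 * a) (m : ℤ) :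
    x ≠ 2 * m * a := by
  rintro rfl
  rcases le_or_gt m 0 with h | h
  · have : (m : ℝ) ≤ 0 := by exact_mod_cast h
    nlinarith
  · have : (1 : ℝ) ≤ m := by exact_mod_cast h
    nlinarith

/-- The value of `℘` at the half period `a`. -/
noncomputable def halfValue₁ (L : PeriodPair) (a : ℝ) : ℝ := (L.weierstrassP a).re

/-- The value of `℘` at the half period `a + b i`. -/
noncomputable def halfValue₂ (L : PeriodPair) (a b : ℝ) : ℝ := (L.weierstrassP (a + b * I)).re

/-- The value of `℘` at the half period `b i`. -/
noncomputable def halfValue₃ (L : PeriodPair) (b : ℝ) : ℝ := (L.weierstrassP (b * I)).re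

namespace IsRectangular

variable {L : PeriodPair} {a b : ℝ}

lemma mem_iff (hL : IsRectangular L a b) {z : ℂ} :
    z ∈ L.lattice ↔ ∃ m n : ℤ, z.re = 2 * m * a ∧ z.im = 2 * n * b := by
  rw [mem_lattice]
  simp only [hL.ω₁_eq, hL.ω₂_eq]
  constructor
  · rintro ⟨m, n, rfl⟩
    exact ⟨m, n, by simp; ring, by simp; ring⟩
  · rintro ⟨m, n, h1, h2⟩
    refine ⟨m, n, Complex.ext ?_ ?_⟩
    · simp [h1]; ring
    · simp [h2]; ring

lemma conj_mem (hL : IsRectangular L a b) : ∀ l ∈ L.lattice, conj l ∈ L.lattice := by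
  intro l hl
  obtain ⟨m, n, h1, h2⟩ := hL.mem_iff.1 hl
  exact hL.mem_iff.2 ⟨m, -n, by simp [h1], by simp [h2]⟩

lemma notMem_of_re (hL : IsRectangular L a b) {z : ℂ} (h0 : 0 < z.re) (h1 : z.re < 2 * a) :
    z ∉ L.lattice := fun hz => by
  obtain ⟨m, n, h, -⟩ := hL.mem_iff.1 hz
  exact ne_two_mul_int_mul hL.a_pos h0 h1 m h

lemma notMem_of_im (hL : IsRectangular L a b) {z : ℂ} (h0 : 0 < z.im) (h1 : z.im < 2 * b) :
    z ∉ L.lattice := fun hz => by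
  obtain ⟨m, n, -, h⟩ := hL.mem_iff.1 hz
  exact ne_two_mul_int_mul hL.b_pos h0 h1 n h

lemma two_mul_mem (hL : IsRectangular L a b) {z : ℂ} (h : z.re = 0 ∨ z.re = a)
    (h' : z.im = 0 ∨ z.im = b) : 2 * z ∈ L.lattice := by
  refine hL.mem_iff.2 ?_
  rcases h with h | h <;> rcases h' with h' | h'
  · exact ⟨0, 0, by simp [h], by simp [h']⟩
  · exact ⟨0, 1, by simp [h], by simp [h']⟩
  · exact ⟨1, 0, by simp [h], by simp [h']⟩
  · exact ⟨1, 1, by simp [h], by simp [h']⟩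

lemma weierstrassP_eq_re_of_sub (hL : IsRectangular L a b) {z : ℂ} (h : z - conj z ∈ L.lattice) :
    L.weierstrassP z = (L.weierstrassP z).re := by
  refine (conj_eq_iff_re.1 ?_).symm
  rw [← weierstrassP_conj hL.conj_mem]
  have := L.weierstrassP_add_coe (conj z) ⟨_, h⟩
  simpa using this.symm

lemma weierstrassP_eq_re_of_add (hL : IsRectangular L a b) {z : ℂ} (h : z + conj z ∈ L.lattice) :
    L.weierstrassP z = (L.weierstrassP z).re := by
  refine (conj_eq_iff_re.1 ?_).symm
  rw [← weierstrassP_conj hL.conj_mem]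
  have := L.weierstrassP_add_coe (-conj z) ⟨_, h⟩
  simpa using this.symm

lemma derivWeierstrassP_eq_re_of_sub (hL : IsRectangular L a b) {z : ℂ}
    (h : z - conj z ∈ L.lattice) : L.derivWeierstrassP z = (L.derivWeierstrassP z).re := by
  refine (conj_eq_iff_re.1 ?_).symm
  rw [← derivWeierstrassP_conj hL.conj_mem]
  have := L.derivWeierstrassP_add_coe (conj z) ⟨_, h⟩
  simpa using this.symm

lemma add_conj_mem (hL : IsRectangular L a b) {z : ℂ} (h : z.re = 0 ∨ z.re = a) :
    z + conj z ∈ L.lattice := by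
  refine hL.mem_iff.2 ?_
  rcases h with h | h
  · exact ⟨0, 0, by simp [h], by simp⟩
  · exact ⟨1, 0, by simp [h]; ring, by simp⟩

lemma half₁ (hL : IsRectangular L a b) : L.weierstrassP a = halfValue₁ L a :=
  hL.weierstrassP_eq_re_of_add (hL.add_conj_mem (by simp))

lemma half₂ (hL : IsRectangular L a b) : L.weierstrassP (a + b * I) = halfValue₂ L a b :=
  hL.weierstrassP_eq_re_of_add (hL.add_conj_mem (by simp))

lemma half₃ (hL : IsRectangular L a b) : L.weierstrassP (b * I) = halfValue₃ L b :=
  hL.weierstrassP_eq_re_of_add (hL.add_conj_mem (by simp))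

lemma notMem₁ (hL : IsRectangular L a b) : (a : ℂ) ∉ L.lattice :=
  hL.notMem_of_re (by simp [hL.a_pos]) (by simp [hL.a_pos])

lemma notMem₂ (hL : IsRectangular L a b) : (a + b * I : ℂ) ∉ L.lattice :=
  hL.notMem_of_re (by simp [hL.a_pos]) (by simp [hL.a_pos])

lemma notMem₃ (hL : IsRectangular L a b) : (b * I : ℂ) ∉ L.lattice :=
  hL.notMem_of_im (by simp [hL.b_pos]) (by simp [hL.b_pos])

lemma half_eq_zero (hL : IsRectangular L a b) {z : ℂ} (hz : z ∉ L.lattice)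
    (h : z.re = 0 ∨ z.re = a) (h' : z.im = 0 ∨ z.im = b) :
    4 * L.weierstrassP z ^ 3 - L.g₂ * L.weierstrassP z - L.g₃ = 0 := by
  rw [← L.derivWeierstrassP_sq z hz,
    (L.derivWeierstrassP_eq_zero_iff hz).2 (hL.two_mul_mem h h')]
  simp

lemma half₁_ne₂ (hL : IsRectangular L a b) : halfValue₁ L a ≠ halfValue₂ L a b := by
  intro h
  have h' : L.weierstrassP (a + b * I) = L.weierstrassP a := by rw [hL.half₁, hL.half₂, h]
  rcases L.weierstrassP_eq_weierstrassP hL.notMem₂ hL.notMem₁ h' with h1 | h1 <;>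
  exact hL.notMem_of_im (by simp [hL.b_pos]) (by simp [hL.b_pos]) h1

lemma half₁_ne₃ (hL : IsRectangular L a b) : halfValue₁ L a ≠ halfValue₃ L b := by
  intro h
  have h' : L.weierstrassP (b * I) = L.weierstrassP a := by rw [hL.half₁, hL.half₃, h]
  rcases L.weierstrassP_eq_weierstrassP hL.notMem₃ hL.notMem₁ h' with h1 | h1 <;>
  exact hL.notMem_of_im (by simp [hL.b_pos]) (by simp [hL.b_pos]) h1

lemma half₂_ne₃ (hL : IsRectangular L a b) : halfValue₂ L a b ≠ halfValue₃ L b := by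
  intro h
  have h' : L.weierstrassP (a + b * I) = L.weierstrassP (b * I) := by rw [hL.half₂, hL.half₃, h]
  rcases L.weierstrassP_eq_weierstrassP hL.notMem₂ hL.notMem₃ h' with h1 | h1 <;>
  exact hL.notMem_of_re (by simp [hL.a_pos]) (by simp [hL.a_pos]) h1

/-- The half values are three distinct roots of 4x³ - g₂x - g₃. Subtracting the equations pairwise
and cancelling the nonzero differences yields Vieta's relations. -/
lemma half_sum_and_g (hL : IsRectangular L a b) :
    halfValue₁ L a + halfValue₂ L a b + halfValue₃ L b = 0 ∧
    ∀ x : ℂ, 4 * x ^ 3 - L.g₂ * x - L.g₃ =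
      4 * (x - halfValue₁ L a) * (x - halfValue₂ L a b) * (x - halfValue₃ L b) := by
  have h1 := hL.half_eq_zero hL.notMem₁ (by simp) (by simp)
  have h2 := hL.half_eq_zero hL.notMem₂ (by simp) (by simp)
  have h3 := hL.half_eq_zero hL.notMem₃ (by simp) (by simp)
  rw [hL.half₁] at h1
  rw [hL.half₂] at h2
  rw [hL.half₃] at h3
  have n12 : (halfValue₁ L a : ℂ) - halfValue₂ L a b ≠ 0 := by
    have := hL.half₁_ne₂; rw [sub_ne_zero]; exact_mod_cast this
  have n13 : (halfValue₁ L a : ℂ) - halfValue₃ L b ≠ 0 := by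
    have := hL.half₁_ne₃; rw [sub_ne_zero]; exact_mod_cast this
  have n23 : (halfValue₂ L a b : ℂ) - halfValue₃ L b ≠ 0 := by
    have := hL.half₂_ne₃; rw [sub_ne_zero]; exact_mod_cast this
  set x₁ : ℂ := (halfValue₁ L a : ℂ)
  set x₂ : ℂ := (halfValue₂ L a b : ℂ)
  set x₃ : ℂ := (halfValue₃ L b : ℂ)
  have g12 : 4 * (x₁ ^ 2 + x₁ * x₂ + x₂ ^ 2) - L.g₂ = 0 :=
    mul_left_cancel₀ n12 (by linear_combination h1 - h2)
  have g13 : 4 * (x₁ ^ 2 + x₁ * x₃ + x₃ ^ 2) - L.g₂ = 0 :=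
    mul_left_cancel₀ n13 (by linear_combination h1 - h3)
  have hs : x₁ + x₂ + x₃ = 0 :=
    mul_left_cancel₀ n23 (by linear_combination (g12 - g13) / 4)
  refine ⟨by
    exact_mod_cast (show (halfValue₁ L a + halfValue₂ L a b + halfValue₃ L b : ℂ) = 0 from hs),
    fun x => ?_⟩
  have e1 : x₃ = -x₁ - x₂ := by linear_combination hs
  rw [e1]
  linear_combination h1 + (x - x₁) * g12

lemma derivWeierstrassP_sq_eq (hL : IsRectangular L a b) {z : ℂ} (hz : z ∉ L.lattice) :
    L.derivWeierstrassP z ^ 2 = 4 * (L.weierstrassP z - halfValue₁ L a) *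
      (L.weierstrassP z - halfValue₂ L a b) * (L.weierstrassP z - halfValue₃ L b) := by
  rw [L.derivWeierstrassP_sq z hz, hL.half_sum_and_g.2]

/-- This fixes the sign of the blow-up at 0: ℘ tends to +∞ along the positive real axis and to -∞
along the imaginary axis. -/
lemma _root_.SineGordon.weierstrassP_sub_bounded (L : PeriodPair) :
    ∃ M : ℝ, ∀ᶠ z in 𝓝[≠] (0 : ℂ), ‖L.weierstrassP z - 1 / z ^ 2‖ ≤ M := by
  have hc := (L.analyticAt_weierstrassPExcept 0).continuousAt
  refine ⟨‖L.weierstrassPExcept 0 0‖ + 1, ?_⟩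
  have h1 := hc.norm.eventually_lt_const (lt_add_one _)
  filter_upwards [mem_nhdsWithin_of_mem_nhds h1] with z hz
  have := L.weierstrassPExcept_add 0 z
  simp only [ZeroMemClass.coe_zero, sub_zero, ne_eq, OfNat.ofNat_ne_zero, not_false_eq_true,
    zero_pow, div_zero] at this
  rw [← this]
  simpa using le_of_lt hz

lemma _root_.SineGordon.tendsto_weierstrassP_re (L : PeriodPair) :
    Tendsto (fun x : ℝ => (L.weierstrassP x).re) (𝓝[>] 0) atTop := by
  obtain ⟨M, hM⟩ := weierstrassP_sub_bounded L
  have h0 : Tendsto (fun x : ℝ => (x : ℂ)) (𝓝[>] 0) (𝓝[≠] 0) := by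
    refine tendsto_nhdsWithin_iff.2 ⟨?_, ?_⟩
    · exact (Complex.continuous_ofReal.tendsto' 0 0 (by simp)).mono_left nhdsWithin_le_nhds
    · filter_upwards [self_mem_nhdsWithin] with x hx
      simpa using (ne_of_gt hx)
  have h1 : Tendsto (fun x : ℝ => (x⁻¹) ^ 2 - M) (𝓝[>] 0) atTop :=
    tendsto_atTop_add_const_right _ _
      ((tendsto_pow_atTop two_ne_zero).comp tendsto_inv_nhdsGT_zero)
  refine tendsto_atTop_mono' _ ?_ h1
  filter_upwards [h0.eventually hM] with x hx
  have h2 := (abs_le.1 ((abs_re_le_norm _).trans hx)).1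
  have h3 : ((1 : ℂ) / (x : ℂ) ^ 2).re = (x⁻¹) ^ 2 := by
    rw [show (1 : ℂ) / (x : ℂ) ^ 2 = ((x⁻¹ ^ 2 : ℝ) : ℂ) by push_cast; rw [inv_pow, one_div]]
    simp only [ofReal_re]
  rw [sub_re, h3] at h2
  linarith

lemma _root_.SineGordon.tendsto_neg_weierstrassP_re (L : PeriodPair) :
    Tendsto (fun x : ℝ => -(L.weierstrassP (x * I)).re) (𝓝[>] 0) atTop := by
  obtain ⟨M, hM⟩ := weierstrassP_sub_bounded L
  have h0 : Tendsto (fun x : ℝ => (x * I : ℂ)) (𝓝[>] 0) (𝓝[≠] 0) := by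
    refine tendsto_nhdsWithin_iff.2 ⟨?_, ?_⟩
    · exact ((Complex.continuous_ofReal.mul continuous_const).tendsto' 0 0 (by simp)).mono_left
        nhdsWithin_le_nhds
    · filter_upwards [self_mem_nhdsWithin] with x hx
      simpa using (ne_of_gt hx)
  have h1 : Tendsto (fun x : ℝ => (x⁻¹) ^ 2 - M) (𝓝[>] 0) atTop :=
    tendsto_atTop_add_const_right _ _
      ((tendsto_pow_atTop two_ne_zero).comp tendsto_inv_nhdsGT_zero)
  refine tendsto_atTop_mono' _ ?_ h1
  filter_upwards [h0.eventually hM] with x hx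
  have h2 := (abs_le.1 ((abs_re_le_norm _).trans hx)).2
  have h3 : ((1 : ℂ) / (x * I : ℂ) ^ 2).re = -(x⁻¹) ^ 2 := by
    rw [show (1 : ℂ) / (x * I : ℂ) ^ 2 = ((-(x⁻¹ ^ 2) : ℝ) : ℂ) by
      push_cast; rw [mul_pow, I_sq, inv_pow, mul_neg_one, div_neg, one_div]]
    simp only [ofReal_re]
  rw [sub_re, h3] at h2
  linarith

lemma hasDerivAt_re_weierstrassP (hL : IsRectangular L a b) {x : ℝ} (h0 : 0 < x) (h1 : x < 2 * a) :
    HasDerivAt (fun x : ℝ => (L.weierstrassP x).re) (L.derivWeierstrassP x).re x :=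
  (L.hasDerivAt_weierstrassP (hL.notMem_of_re (by simpa) (by simpa))).real_of_complex

lemma _root_.SineGordon.hasDerivAt_re_weierstrassP_vertical (L : PeriodPair) {s t : ℝ}
    (h : (s + t * I : ℂ) ∉ L.lattice) :
    HasDerivAt (fun t : ℝ => (L.weierstrassP (s + t * I)).re)
      (I * L.derivWeierstrassP (s + t * I)).re t := by
  have h1 : HasDerivAt (fun t : ℂ => (s + t * I : ℂ)) I (t : ℂ) := by
    simpa using ((hasDerivAt_id (t : ℂ)).mul_const I).const_add (s : ℂ)
  have h2 := (L.hasDerivAt_weierstrassP h).comp (t : ℂ) h1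
  rw [mul_comm] at h2
  exact h2.real_of_complex

end IsRectangular

end SineGordon

/-! ### Half periods as complete elliptic integrals. -/

namespace SineGordon

open Filter Topology Set

lemma one_sub_mul_sin_sq_pos {k : ℝ} (hk : k ^ 2 < 1) (y : ℝ) : 0 < 1 - k ^ 2 * Real.sin y ^ 2 := by
  nlinarith [Real.sin_sq_le_one y, sq_nonneg (Real.sin y), sq_nonneg k]

lemma continuous_ellipticK_integrand {k : ℝ} (hk : k ^ 2 < 1) :
    Continuous fun y : ℝ => 1 / √(1 - k ^ 2 * Real.sin y ^ 2) :=
  Continuous.div continuous_const (by fun_prop) fun y =>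
    (Real.sqrt_pos.2 (one_sub_mul_sin_sq_pos hk y)).ne'

lemma ellipticK_lt_ellipticK {k l : ℝ} (hkl : k ^ 2 < l ^ 2) (hl : l ^ 2 < 1) :
    ellipticK k < ellipticK l := by
  have hπ : (0 : ℝ) < Real.pi / 2 := by positivity
  have h1 : ∀ y ∈ Ioc (0 : ℝ) (Real.pi / 2), 1 / √(1 - k ^ 2 * Real.sin y ^ 2) <
      1 / √(1 - l ^ 2 * Real.sin y ^ 2) := by
    intro y hy
    have hs : 0 < Real.sin y := Real.sin_pos_of_pos_of_lt_pi hy.1 (by linarith [hy.2])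
    have := one_sub_mul_sin_sq_pos hl y
    refine one_div_lt_one_div_of_lt (Real.sqrt_pos.2 this) (Real.sqrt_lt_sqrt this.le ?_)
    have := mul_lt_mul_of_pos_right hkl (pow_pos hs 2)
    linarith
  refine intervalIntegral.integral_lt_integral_of_continuousOn_of_le_of_exists_lt hπ
    (continuous_ellipticK_integrand (hkl.trans hl)).continuousOn
    (continuous_ellipticK_integrand hl).continuousOn (fun y hy => (h1 y hy).le)
    ⟨Real.pi / 2, ⟨hπ.le, le_rfl⟩, h1 _ ⟨hπ, le_rfl⟩⟩

/-- Ratios of complete elliptic integrals determine modulus and scale. -/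
lemma eq_of_ellipticK_eq {k k' l l' s t u v : ℝ} (hk : k ^ 2 + k' ^ 2 = 1)
    (hl : l ^ 2 + l' ^ 2 = 1) (hk0 : 0 < k ^ 2) (hk1 : k ^ 2 < 1) (hl0 : 0 < l ^ 2)
    (hl1 : l ^ 2 < 1) (hs : 0 < s) (ht : 0 < t)
    (h1 : s * u = ellipticK k) (h2 : s * v = ellipticK k')
    (h3 : t * u = ellipticK l) (h4 : t * v = ellipticK l') : k ^ 2 = l ^ 2 ∧ s = t := by
  have key : ∀ {k k' l l' s t u v : ℝ}, k ^ 2 + k' ^ 2 = 1 → l ^ 2 + l' ^ 2 = 1 → 0 < k ^ 2 →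
      k ^ 2 < 1 → 0 < l ^ 2 → l ^ 2 < 1 → 0 < s → 0 < t → s * u = ellipticK k →
      s * v = ellipticK k' → t * u = ellipticK l → t * v = ellipticK l' → ¬ k ^ 2 < l ^ 2 := by
    intro k k' l l' s t u v hk hl hk0 hk1 hl0 hl1 hs ht h1 h2 h3 h4 hkl
    -- Raising the modulus lowers the complementary one, so K(k) < K(l) and K(l') < K(k'). The
    -- common factors u and v would then give both s < t and t < s.
    have a1 := ellipticK_lt_ellipticK hkl hl1
    have a2 := ellipticK_lt_ellipticK (k := l') (l := k') (by linarith) (by linarith)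
    have b1 := ellipticK_pos hk1
    have b2 := ellipticK_pos (k := l') (by linarith)
    have hu : 0 < u := pos_of_mul_pos_right (h1 ▸ b1) hs.le
    have hv : 0 < v := pos_of_mul_pos_right (h4 ▸ b2) ht.le
    rw [← h1, ← h3] at a1
    rw [← h2, ← h4] at a2
    have c1 := lt_of_mul_lt_mul_right a1 hu.le
    have c2 := lt_of_mul_lt_mul_right a2 hv.le
    linarith
  have e : k ^ 2 = l ^ 2 := le_antisymm
    (not_lt.1 (key hl hk hl0 hl1 hk0 hk1 ht hs h3 h4 h1 h2))
    (not_lt.1 (key hk hl hk0 hk1 hl0 hl1 hs ht h1 h2 h3 h4))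
  refine ⟨e, ?_⟩
  have hpos := ellipticK_pos hk1
  have hu : u ≠ 0 := by rintro rfl; simp at h1; linarith
  have : ellipticK k = ellipticK l := by simp only [ellipticK, e]
  exact mul_right_cancel₀ hu (by rw [h1, h3, this])

/-- A function `p` on `(0, ω]` with a pole at `0`, reaching `e₁` at `ω`, which solves
`p'² = 4 (p - e₁) (p - e₂) (p - e₃)` without critical points in between. -/
structure IsHalfPeriodMap (p p' : ℝ → ℝ) (ω e₁ e₂ e₃ : ℝ) : Prop where
  pos : 0 < ω
  hasDerivAt : ∀ x ∈ Ioc 0 ω, HasDerivAt p (p' x) x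
  ne_zero : ∀ x ∈ Ioo 0 ω, p' x ≠ 0
  sq_eq : ∀ x ∈ Ioc 0 ω, p' x ^ 2 = 4 * (p x - e₁) * (p x - e₂) * (p x - e₃)
  tendsto : Tendsto p (𝓝[>] 0) atTop
  apply_eq : p ω = e₁

namespace IsHalfPeriodMap

variable {p p' : ℝ → ℝ} {ω e₁ e₂ e₃ : ℝ}

lemma continuousOn (h : IsHalfPeriodMap p p' ω e₁ e₂ e₃) : ContinuousOn p (Ioc 0 ω) :=
  fun x hx => (h.hasDerivAt x hx).continuousAt.continuousWithinAt

lemma exists_gt (h : IsHalfPeriodMap p p' ω e₁ e₂ e₃) (y δ : ℝ) (hδ : 0 < δ) :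
    ∃ x, 0 < x ∧ x < δ ∧ y < p x := by
  have h1 := h.tendsto.eventually_gt_atTop y
  obtain ⟨x, hx, hx'⟩ := (h1.and (Ioo_mem_nhdsGT hδ)).exists
  exact ⟨x, hx'.1, hx'.2, hx⟩

/-- By Darboux's theorem a derivative without zeros keeps its sign; a positive sign contradicts p →
+∞ at 0. -/
lemma deriv_neg (h : IsHalfPeriodMap p p' ω e₁ e₂ e₃) : ∀ x ∈ Ioo 0 ω, p' x < 0 := by
  rcases hasDerivWithinAt_forall_lt_or_forall_gt_of_forall_ne (convex_Ioo 0 ω)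
    (fun x hx => (h.hasDerivAt x (Ioo_subset_Ioc_self hx)).hasDerivWithinAt) h.ne_zero with h1 | h1
  · exact h1
  · exfalso
    have hmono : StrictMonoOn p (Ioc 0 ω) := by
      refine strictMonoOn_of_deriv_pos (convex_Ioc 0 ω) h.continuousOn fun x hx => ?_
      rw [interior_Ioc] at hx
      rw [(h.hasDerivAt x (Ioo_subset_Ioc_self hx)).deriv]
      exact h1 x hx
    obtain ⟨x, h2, h3, h4⟩ := h.exists_gt (p ω) ω h.pos
    exact absurd (hmono ⟨h2, h3.le⟩ ⟨h.pos, le_rfl⟩ h3) (by linarith)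

lemma strictAntiOn (h : IsHalfPeriodMap p p' ω e₁ e₂ e₃) : StrictAntiOn p (Ioc 0 ω) := by
  refine strictAntiOn_of_deriv_neg (convex_Ioc 0 ω) h.continuousOn fun x hx => ?_
  rw [interior_Ioc] at hx
  rw [(h.hasDerivAt x (Ioo_subset_Ioc_self hx)).deriv]
  exact h.deriv_neg x hx

lemma lt_apply (h : IsHalfPeriodMap p p' ω e₁ e₂ e₃) {x : ℝ} (hx : x ∈ Ioo 0 ω) : e₁ < p x := by
  rw [← h.apply_eq]
  exact h.strictAntiOn ⟨hx.1, hx.2.le⟩ ⟨h.pos, le_rfl⟩ hx.2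

lemma exists_eq (h : IsHalfPeriodMap p p' ω e₁ e₂ e₃) {y : ℝ} (hy : e₁ ≤ y) :
    ∃ x ∈ Ioc 0 ω, p x = y := by
  obtain ⟨x, h2, h3, h4⟩ := h.exists_gt y ω h.pos
  obtain ⟨z, hz, hz'⟩ := intermediate_value_Icc' h3.le
    (h.continuousOn.mono fun z hz => ⟨h2.trans_le hz.1, hz.2⟩) ⟨by rwa [h.apply_eq], h4.le⟩
  exact ⟨z, ⟨h2.trans_le hz.1, hz.2⟩, hz'⟩

/-- If e₂ exceeded e₁, then p would take the value e₂ at an interior point, which would be critical.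
-/
lemma le (h : IsHalfPeriodMap p p' ω e₁ e₂ e₃) : e₂ ≤ e₁ := by
  by_contra! hlt
  obtain ⟨x, hx, hx'⟩ := h.exists_eq hlt.le
  have hxω : x < ω := lt_of_le_of_ne hx.2 (by rintro rfl; rw [h.apply_eq] at hx'; linarith)
  have := h.sq_eq x hx
  rw [hx', sub_self, mul_zero, zero_mul] at this
  exact h.ne_zero x ⟨hx.1, hxω⟩ (pow_eq_zero_iff two_ne_zero |>.1 this)

/-- The half period is a complete elliptic integral. -/
lemma sqrt_mul_eq_ellipticK (h : IsHalfPeriodMap p p' ω e₁ e₂ e₃) (h32 : e₃ < e₂) (h21 : e₂ < e₁) :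
    √(e₁ - e₃) * ω = ellipticK √((e₂ - e₃) / (e₁ - e₃)) := by
  set r := √(e₁ - e₃) with hr
  set k := √((e₂ - e₃) / (e₁ - e₃)) with hk
  have h31 : 0 < e₁ - e₃ := by linarith
  have hr0 : 0 < r := Real.sqrt_pos.2 h31
  have hr2 : r ^ 2 = e₁ - e₃ := Real.sq_sqrt h31.le
  have hk2 : k ^ 2 = (e₂ - e₃) / (e₁ - e₃) := Real.sq_sqrt (div_nonneg (by linarith) h31.le)
  have hk1 : k ^ 2 < 1 := by rw [hk2, div_lt_one h31]; linarith
  have hcont := continuous_ellipticK_integrand hk1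
  set G : ℝ → ℝ := fun y => ∫ t in (0 : ℝ)..y, 1 / √(1 - k ^ 2 * Real.sin t ^ 2) with hG
  have hGd : ∀ y, HasDerivAt G (1 / √(1 - k ^ 2 * Real.sin y ^ 2)) y := fun y =>
    intervalIntegral.integral_hasDerivAt_right (hcont.intervalIntegrable _ _)
      hcont.aestronglyMeasurable.stronglyMeasurableAtFilter hcont.continuousAt
  have hGc : Continuous G := continuous_iff_continuousAt.2 fun y => (hGd y).continuousAt
  -- Legendre's substitution sin φ = √((e₁ - e₃)/(p - e₃)): s runs from 0 at the pole to 1 at ω, and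
  -- the incomplete integral at φ = arcsin s grows at the constant rate r.
  set s : ℝ → ℝ := fun x => r / √(p x - e₃) with hs
  set Ψ : ℝ → ℝ := fun x => G (Real.arcsin (s x)) - r * x with hΨ
  have hder : ∀ x ∈ Ioo 0 ω, HasDerivAt Ψ 0 x := by
    intro x hx
    have hx' := Ioo_subset_Ioc_self hx
    have hp1 : 0 < p x - e₁ := sub_pos.2 (h.lt_apply hx)
    have hp2 : 0 < p x - e₂ := by linarith
    have hp3 : 0 < p x - e₃ := by linarith
    set w := √(p x - e₃) with hw
    have hw0 : 0 < w := Real.sqrt_pos.2 hp3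
    have hw2 : w ^ 2 = p x - e₃ := Real.sq_sqrt hp3.le
    have hsd : HasDerivAt s (-(r * (p' x / (2 * w))) / w ^ 2) x := by
      have := (hasDerivAt_const x r).div (((h.hasDerivAt x hx').sub_const e₃).sqrt hp3.ne') hw0.ne'
      convert! this using 1
      ring
    have hs0 : 0 < s x := div_pos hr0 hw0
    have hs2 : s x ^ 2 = (e₁ - e₃) / (p x - e₃) := by rw [hs, div_pow, hr2, hw2]
    have hs1 : s x ^ 2 < 1 := by rw [hs2, div_lt_one hp3]; linarith
    have hs1' : s x < 1 := by nlinarith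
    have harc := (Real.hasDerivAt_arcsin (by linarith) hs1'.ne).comp x hsd
    have htot := ((hGd _).comp x harc).sub ((hasDerivAt_id x).const_mul r)
    convert! htot using 1
    rw [Function.comp_apply, Real.sin_arcsin (by linarith) hs1'.le]
    have hc1 : √(1 - s x ^ 2) = √(p x - e₁) / w := by
      rw [hw, ← Real.sqrt_div hp1.le, hs2]
      congr 1
      field_simp
      ring
    have hc2 : √(1 - k ^ 2 * s x ^ 2) = √(p x - e₂) / w := by
      rw [hw, ← Real.sqrt_div hp2.le, hs2, hk2]
      congr 1
      field_simp
      ring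
    have hp' : p' x = -(2 * √(p x - e₁) * √(p x - e₂) * w) := by
      have hsq : p' x ^ 2 = (2 * √(p x - e₁) * √(p x - e₂) * w) ^ 2 := by
        rw [h.sq_eq x hx', mul_pow, mul_pow, mul_pow, Real.sq_sqrt hp1.le, Real.sq_sqrt hp2.le, hw2]
        ring
      rcases sq_eq_sq_iff_eq_or_eq_neg.1 hsq with h1 | h1
      · have h2 := h.deriv_neg x hx
        have : 0 ≤ 2 * √(p x - e₁) * √(p x - e₂) * w := by positivity
        linarith
      · exact h1
    have g1 : √(p x - e₁) ≠ 0 := (Real.sqrt_pos.2 hp1).ne'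
    have g2 : √(p x - e₂) ≠ 0 := (Real.sqrt_pos.2 hp2).ne'
    rw [hc1, hc2, hp']
    field_simp
    ring
  obtain ⟨C, hC⟩ := isOpen_Ioo.exists_is_const_of_deriv_eq_zero isPreconnected_Ioo
    (fun x hx => (hder x hx).differentiableAt.differentiableWithinAt)
    (fun x hx => (hder x hx).deriv)
  have hlim0 : Tendsto Ψ (𝓝[>] 0) (𝓝 0) := by
    have t1 : Tendsto s (𝓝[>] 0) (𝓝 0) :=
      Tendsto.div_atTop tendsto_const_nhds
        (Real.tendsto_sqrt_atTop.comp (tendsto_atTop_add_const_right _ (-e₃) h.tendsto))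
    have t2 : Tendsto (fun x => G (Real.arcsin (s x))) (𝓝[>] 0) (𝓝 0) := by
      have hG0 : (G ∘ Real.arcsin) 0 = 0 := by simp [hG]
      exact ((hGc.comp Real.continuous_arcsin).tendsto' 0 0 hG0).comp t1
    have t3 : Tendsto (fun x => r * x) (𝓝[>] 0) (𝓝 0) :=
      ((continuous_const.mul continuous_id).tendsto' 0 0 (by simp)).mono_left nhdsWithin_le_nhds
    simpa using t2.sub t3
  have hC0 : C = 0 := by
    refine tendsto_nhds_unique (tendsto_const_nhds.congr' ?_) hlim0
    filter_upwards [Ioo_mem_nhdsGT h.pos] with x hx using (hC x hx).symm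
  -- The arcsine is not differentiable at s ω = 1, so this endpoint is reached by continuity alone.
  have hω : Tendsto Ψ (𝓝[<] ω) (𝓝 (Ψ ω)) := by
    have hpω : ContinuousAt p ω := (h.hasDerivAt ω ⟨h.pos, le_rfl⟩).continuousAt
    have hsω : ContinuousAt s ω :=
      continuousAt_const.div (hpω.sub continuousAt_const).sqrt (by rw [h.apply_eq]; exact hr0.ne')
    have : ContinuousAt Ψ ω :=
      ((hGc.comp Real.continuous_arcsin).continuousAt.comp hsω).sub
        (continuousAt_const.mul continuousAt_id)
    exact this.tendsto.mono_left nhdsWithin_le_nhds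
  have hfin : Ψ ω = 0 := by
    refine tendsto_nhds_unique hω (tendsto_const_nhds.congr' ?_)
    filter_upwards [Ioo_mem_nhdsLT h.pos] with x hx
    rw [hC x hx, hC0]
  have hsω : s ω = 1 := by simp only [hs, h.apply_eq]; exact div_self hr0.ne'
  simp only [hΨ, hsω, Real.arcsin_one, hG] at hfin
  rw [ellipticK]
  linarith

end IsHalfPeriodMap

end SineGordon

/-! ### Recovering the half values from the periods; location of points with real ℘. -/

namespace SineGordon

open Filter Topology Set

open PeriodPair Complex ComplexConjugate

lemma weierstrassZeta_add_int_mul (L : PeriodPair) {w : ℂ} (hw : w ∉ L.lattice)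
    (hw2 : 2 * w ∈ L.lattice) {z : ℂ} (hz : z ∉ L.lattice) (m : ℤ) :
    weierstrassZeta L (z + 2 * m * w) = weierstrassZeta L z + 2 * m * weierstrassZeta L w := by
  have hmem : ∀ m : ℤ, z + 2 * m * w ∉ L.lattice := by
    intro m hm
    have h1 : (m : ℂ) * (2 * w) ∈ L.lattice := by
      simpa using L.lattice.smul_mem m hw2
    refine hz ?_
    have h2 := L.lattice.sub_mem hm h1
    rwa [show z + 2 * m * w - m * (2 * w) = z by ring] at h2
  induction m using Int.induction_on with
  | zero => simp
  | succ n ih =>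
    have := weierstrassZeta_add L hw hw2 (hmem n)
    push_cast at this ih ⊢
    rw [show z + 2 * (n + 1) * w = z + 2 * n * w + 2 * w by ring, this, ih]
    ring
  | pred n ih =>
    have := weierstrassZeta_add L hw hw2 (hmem (-n - 1))
    push_cast at this ih ⊢
    rw [show z + 2 * (-n - 1) * w + 2 * w = z + 2 * -n * w by ring, ih] at this
    linear_combination -this

namespace IsRectangular

variable {L : PeriodPair} {a b : ℝ}

lemma derivWeierstrassP_re_eq_zero (hL : IsRectangular L a b) {z : ℂ}
    (h : z + conj z ∈ L.lattice) : (L.derivWeierstrassP z).re = 0 := by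
  have h1 := L.derivWeierstrassP_add_coe (-z) ⟨_, h⟩
  rw [show -z + (z + conj z) = conj z by ring, L.derivWeierstrassP_neg,
    derivWeierstrassP_conj hL.conj_mem] at h1
  have := congrArg re h1
  simp only [conj_re, neg_re] at this
  linarith

lemma isHalfPeriodMap_real (hL : IsRectangular L a b) :
    IsHalfPeriodMap (fun x : ℝ => (L.weierstrassP x).re) (fun x : ℝ => (L.derivWeierstrassP x).re)
      a (halfValue₁ L a) (halfValue₂ L a b) (halfValue₃ L b) where
  pos := hL.a_pos
  hasDerivAt x hx := hL.hasDerivAt_re_weierstrassP hx.1 (by linarith [hx.2, hL.a_pos])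
  ne_zero x hx h := by
    have h1 : (x : ℂ) ∉ L.lattice := hL.notMem_of_re (by simpa using hx.1)
      (by simpa using hx.2.trans (by linarith [hL.a_pos]))
    have h2 : L.derivWeierstrassP x = 0 := by
      rw [hL.derivWeierstrassP_eq_re_of_sub (by simp), h, ofReal_zero]
    exact hL.notMem_of_re (by simpa using hx.1) (by simpa using hx.2)
      ((L.derivWeierstrassP_eq_zero_iff h1).1 h2)
  sq_eq x hx := by
    have h1 : (x : ℂ) ∉ L.lattice := hL.notMem_of_re (by simpa using hx.1)
      (by simpa using hx.2.trans_lt (by linarith [hL.a_pos]))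
    have h2 := hL.derivWeierstrassP_sq_eq h1
    rw [hL.derivWeierstrassP_eq_re_of_sub (by simp), hL.weierstrassP_eq_re_of_sub (by simp)] at h2
    exact_mod_cast h2
  tendsto := tendsto_weierstrassP_re L
  apply_eq := rfl

/-- The change of sign makes the pole positive and reverses the order of the eᵢ, which replaces the
modulus by the complementary one. -/
lemma isHalfPeriodMap_imaginary (hL : IsRectangular L a b) :
    IsHalfPeriodMap (fun t : ℝ => -(L.weierstrassP (t * I)).re)
      (fun t : ℝ => -(I * L.derivWeierstrassP (t * I)).re)
      b (-halfValue₃ L b) (-halfValue₂ L a b) (-halfValue₁ L a) where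
  pos := hL.b_pos
  hasDerivAt t ht := by
    have h1 : (t * I : ℂ) ∉ L.lattice := hL.notMem_of_im (by simpa using ht.1)
      (by simpa using ht.2.trans_lt (by linarith [hL.b_pos]))
    have := (hasDerivAt_re_weierstrassP_vertical L (s := 0) (t := t) (by simpa using h1)).neg
    simp only [ofReal_zero, zero_add] at this
    exact this
  ne_zero t ht h := by
    have h1 : (t * I : ℂ) ∉ L.lattice := hL.notMem_of_im (by simpa using ht.1)
      (by simpa using ht.2.trans (by linarith [hL.b_pos]))
    have h2 : L.derivWeierstrassP (t * I) = 0 := by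
      refine Complex.ext (hL.derivWeierstrassP_re_eq_zero (hL.add_conj_mem (by simp))) ?_
      simpa using h
    exact hL.notMem_of_im (by simpa using ht.1) (by simpa using ht.2)
      ((L.derivWeierstrassP_eq_zero_iff h1).1 h2)
  sq_eq t ht := by
    have h1 : (t * I : ℂ) ∉ L.lattice := hL.notMem_of_im (by simpa using ht.1)
      (by simpa using ht.2.trans_lt (by linarith [hL.b_pos]))
    have h2 := hL.derivWeierstrassP_sq_eq h1
    have h3 := hL.derivWeierstrassP_re_eq_zero (z := t * I) (hL.add_conj_mem (by simp))
    rw [hL.weierstrassP_eq_re_of_add (hL.add_conj_mem (by simp))] at h2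
    have h4 := congrArg re h2
    rw [sq, mul_re, h3] at h4
    have h5 : ∀ p q r s : ℝ, (4 * ((p : ℂ) - q) * (p - r) * (p - s)).re =
      4 * (p - q) * (p - r) * (p - s) := fun p q r s => by
        rw [← ofReal_re (4 * (p - q) * (p - r) * (p - s))]; push_cast; rfl
    rw [h5] at h4
    simp only [mul_re, I_re, I_im, h3]
    linear_combination -h4
  tendsto := tendsto_neg_weierstrassP_re L
  apply_eq := rfl

lemma half₂_lt₁ (hL : IsRectangular L a b) : halfValue₂ L a b < halfValue₁ L a :=
  lt_of_le_of_ne hL.isHalfPeriodMap_real.le hL.half₁_ne₂.symm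

lemma half₃_lt₂ (hL : IsRectangular L a b) : halfValue₃ L b < halfValue₂ L a b :=
  lt_of_le_of_ne (neg_le_neg_iff.1 hL.isHalfPeriodMap_imaginary.le) hL.half₂_ne₃.symm

/-- The half period values of the lattice with half periods `K(k) / t` and `i K(k') / t`. -/
lemma half_eq (hL : IsRectangular L a b) {k t : ℝ} (hk0 : 0 < k ^ 2) (hk1 : k ^ 2 < 1) (ht : 0 < t)
    (ha : t * a = ellipticK k) (hb : t * b = ellipticK √(1 - k ^ 2)) :
    halfValue₁ L a = (2 - k ^ 2) * t ^ 2 / 3 ∧ halfValue₂ L a b = (2 * k ^ 2 - 1) * t ^ 2 / 3 ∧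
      halfValue₃ L b = -(1 + k ^ 2) * t ^ 2 / 3 := by
  have h12 := hL.half₂_lt₁
  have h23 := hL.half₃_lt₂
  have hsum := hL.half_sum_and_g.1
  have h1 := hL.isHalfPeriodMap_real.sqrt_mul_eq_ellipticK h23 h12
  have h2 := hL.isHalfPeriodMap_imaginary.sqrt_mul_eq_ellipticK (by linarith) (by linarith)
  rw [show -halfValue₃ L b - -halfValue₁ L a = halfValue₁ L a - halfValue₃ L b by ring] at h2
  rw [show -halfValue₂ L a b - -halfValue₁ L a = halfValue₁ L a - halfValue₂ L a b by ring] at h2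
  set e₁ := halfValue₁ L a
  set e₂ := halfValue₂ L a b
  set e₃ := halfValue₃ L b
  have h13 : 0 < e₁ - e₃ := by linarith
  have hs1 : √((e₂ - e₃) / (e₁ - e₃)) ^ 2 = (e₂ - e₃) / (e₁ - e₃) :=
    Real.sq_sqrt (div_nonneg (by linarith) h13.le)
  have hs2 : √((e₁ - e₂) / (e₁ - e₃)) ^ 2 = (e₁ - e₂) / (e₁ - e₃) :=
    Real.sq_sqrt (div_nonneg (by linarith) h13.le)
  have hs3 : √(1 - k ^ 2) ^ 2 = 1 - k ^ 2 := Real.sq_sqrt (by linarith)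
  obtain ⟨hk, hst⟩ := eq_of_ellipticK_eq
    (by rw [hs1, hs2, ← add_div, div_eq_one_iff_eq h13.ne']; ring)
    (l := k) (by rw [hs3]; ring) (by rw [hs1]; exact div_pos (by linarith) h13)
    (by rw [hs1, div_lt_one h13]; linarith) hk0 hk1 (Real.sqrt_pos.2 h13) ht h1 h2 ha hb
  have ht2 : e₁ - e₃ = t ^ 2 := by rw [← hst, Real.sq_sqrt h13.le]
  rw [hs1, div_eq_iff h13.ne', ht2] at hk
  refine ⟨?_, ?_, ?_⟩
  · linear_combination hsum / 3 + 2 / 3 * ht2 - hk / 3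
  · linear_combination hsum / 3 - 1 / 3 * ht2 + 2 / 3 * hk
  · linear_combination hsum / 3 - 1 / 3 * ht2 - hk / 3

/-- Here ℘'(ρ)² ≤ 0, so ℘'(ρ) is imaginary. Then ℘ and ℘' agree at conj ρ and at -ρ, which are
therefore congruent. -/
lemma add_conj_mem_of_weierstrassP_eq (hL : IsRectangular L a b) {ρ : ℂ} {P : ℝ}
    (hρ : ρ ∉ L.lattice) (h : L.weierstrassP ρ = P)
    (hP : (P - halfValue₁ L a) * (P - halfValue₂ L a b) * (P - halfValue₃ L b) ≤ 0) :
    ρ + conj ρ ∈ L.lattice := by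
  have hcρ : conj ρ ∉ L.lattice := fun h' => hρ (by simpa using hL.conj_mem _ h')
  have hc : L.weierstrassP (conj ρ) = L.weierstrassP ρ := by
    rw [weierstrassP_conj hL.conj_mem, h, conj_ofReal]
  have hsq := hL.derivWeierstrassP_sq_eq hρ
  rw [h, show (4 * (P - halfValue₁ L a) * (P - halfValue₂ L a b) * (P - halfValue₃ L b) : ℂ) =
    ((4 * ((P - halfValue₁ L a) * (P - halfValue₂ L a b) * (P - halfValue₃ L b)) : ℝ) : ℂ) by
      push_cast; ring] at hsq
  have hre := congrArg re hsq
  have him := congrArg im hsq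
  rw [sq, mul_re, ofReal_re] at hre
  rw [sq, mul_im, ofReal_im] at him
  have hz : (L.derivWeierstrassP ρ).re = 0 := by
    rcases mul_eq_zero.1 (show (L.derivWeierstrassP ρ).re * (L.derivWeierstrassP ρ).im = 0 by
      linarith) with h0 | h0
    · exact h0
    · rw [h0] at hre
      nlinarith
  have := L.sub_mem_lattice_of_eq (a := conj ρ) (b := -ρ) hcρ (by simpa using hρ)
    (by simpa using hc) (by
      rw [derivWeierstrassP_conj hL.conj_mem, L.derivWeierstrassP_neg]
      exact Complex.ext (by simp [hz]) (by simp))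
  simpa [add_comm] using this

/-- Re ρ = ma for an integer m and conj ρ = -ρ + 2ma, so quasi-periodicity gives Re ζ_w(ρ) = m
ζ_w(a) with ζ_w(a) real; the two real parts cancel. -/
lemma re_weierstrassZeta_sub_eq_zero (hL : IsRectangular L a b) {ρ : ℂ}
    (hρ : ρ ∉ L.lattice) (h : ρ + conj ρ ∈ L.lattice) :
    (weierstrassZeta L ρ * a - weierstrassZeta L a * ρ).re = 0 := by
  obtain ⟨m, n, h1, -⟩ := hL.mem_iff.1 h
  have hm : ρ.re = m * a := by
    simp only [add_re, conj_re] at h1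
    linarith
  have hconj : conj ρ = -ρ + 2 * m * a := by
    apply Complex.ext
    · simp [hm]; ring
    · simp
  have hz := weierstrassZeta_add_int_mul L hL.notMem₁ (hL.two_mul_mem (by simp) (by simp))
    (z := -ρ) (by simpa using hρ) m
  rw [← hconj, weierstrassZeta_neg, weierstrassZeta_conj hL.conj_mem] at hz
  have hreal : (weierstrassZeta L a).im = 0 := by
    have := weierstrassZeta_conj hL.conj_mem a
    rw [conj_ofReal] at this
    exact conj_eq_iff_im.1 this.symm
  have := congrArg re hz
  simp [hreal] at this
  simp [hreal, hm]
  linear_combination a / 2 * this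

lemma exists_imaginary (hL : IsRectangular L a b) {P : ℝ} (hP : P ≤ halfValue₃ L b) :
    ∃ ρ : ℂ, ρ ∉ L.lattice ∧ L.weierstrassP ρ = P ∧ ρ.re = 0 ∧ (weierstrassZeta L ρ).re = 0 := by
  obtain ⟨t, ht, htP⟩ := hL.isHalfPeriodMap_imaginary.exists_eq (neg_le_neg hP)
  have h1 : (t * I : ℂ) ∉ L.lattice := hL.notMem_of_im (by simpa using ht.1)
    (by simpa using ht.2.trans_lt (by linarith [hL.b_pos]))
  refine ⟨t * I, h1, ?_, by simp, ?_⟩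
  · rw [hL.weierstrassP_eq_re_of_add (hL.add_conj_mem (by simp)), neg_inj.1 htP]
  · have h2 := weierstrassZeta_conj hL.conj_mem (t * I)
    rw [map_mul, conj_ofReal, conj_I, mul_neg, weierstrassZeta_neg] at h2
    have := congrArg re h2
    simp only [conj_re, neg_re] at this
    linarith

lemma exists_vertical (hL : IsRectangular L a b) {P : ℝ} (h2 : halfValue₂ L a b ≤ P)
    (h1 : P ≤ halfValue₁ L a) : ∃ ρ : ℂ, ρ ∉ L.lattice ∧ L.weierstrassP ρ = P := by
  have hmem : ∀ t : ℝ, (a + t * I : ℂ) ∉ L.lattice := fun t =>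
    hL.notMem_of_re (by simp [hL.a_pos]) (by simp [hL.a_pos])
  have hc : Continuous fun t : ℝ => (L.weierstrassP (a + t * I)).re :=
    continuous_iff_continuousAt.2 fun t =>
      (hasDerivAt_re_weierstrassP_vertical L (hmem t)).continuousAt
  obtain ⟨t, -, ht⟩ := intermediate_value_Icc' hL.b_pos.le hc.continuousOn
    ⟨h2, by simpa [halfValue₁] using h1⟩
  refine ⟨a + t * I, hmem t, ?_⟩
  rw [hL.weierstrassP_eq_re_of_add (hL.add_conj_mem (by simp))]
  exact congrArg ofReal ht

/-- The sign condition means P ≤ e₃ or e₂ ≤ P ≤ e₁. The first range is covered by the imaginary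
axis, the second by the vertical segment from a to a + bi. -/
lemma exists_weierstrassP_eq (hL : IsRectangular L a b) {P : ℝ}
    (hP : (P - halfValue₁ L a) * (P - halfValue₂ L a b) * (P - halfValue₃ L b) ≤ 0) :
    ∃ ρ : ℂ, ρ ∉ L.lattice ∧ L.weierstrassP ρ = P := by
  have h12 := hL.half₂_lt₁
  have h23 := hL.half₃_lt₂
  rcases le_or_gt P (halfValue₃ L b) with h | h
  · obtain ⟨ρ, h1, h2, -⟩ := hL.exists_imaginary h
    exact ⟨ρ, h1, h2⟩
  · have h' := nonpos_of_mul_nonpos_left hP (sub_pos.2 h)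
    refine hL.exists_vertical ?_ ?_ <;> by_contra! hlt
    · nlinarith [mul_pos (show 0 < halfValue₁ L a - P by linarith) (sub_pos.2 hlt)]
    · nlinarith [mul_pos (show 0 < P - halfValue₂ L a b by linarith) (sub_pos.2 hlt)]

end IsRectangular

end SineGordon

/-! ### The lattice and the Lax parameter in terms of c and E. -/

namespace SineGordon

open Complex

variable {c E : ℝ}

lemma Admissible.isRectangular (h : Admissible c E) :
    IsRectangular (waveLattice h) (omega1 c E) (omega3Im c E) where
  a_pos := h.omega1_pos
  b_pos := h.omega3Im_pos
  ω₁_eq := rfl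
  ω₂_eq := rfl

lemma Admissible.sq_sub_one_ne_zero (h : Admissible c E) : c ^ 2 - 1 ≠ 0 := by
  rcases h with ⟨hc, -⟩ | ⟨hc, -⟩
  · have := (sq_lt_one_iff_abs_lt_one c).2 hc
    linarith
  · have := (one_lt_sq_iff_one_lt_abs c).2 hc
    linarith

lemma Admissible.sub_one_ne_zero (h : Admissible c E) : c - 1 ≠ 0 := fun h0 =>
  h.sq_sub_one_ne_zero (by linear_combination (c + 1) * h0)

lemma Admissible.add_one_ne_zero (h : Admissible c E) : c + 1 ≠ 0 := fun h0 =>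
  h.sq_sub_one_ne_zero (by linear_combination (c - 1) * h0)

/-- The smallest half period value and the cubic of the lattice, in terms of `c` and `E`. -/
lemma Admissible.half_values (h : Admissible c E) :
    halfValue₃ (waveLattice h) (omega3Im c E) =
      -(E - 1) / (6 * (c ^ 2 - 1)) - 1 / (2 * |c ^ 2 - 1|) ∧
    ∀ x : ℝ, (x - halfValue₁ (waveLattice h) (omega1 c E)) *
      (x - halfValue₂ (waveLattice h) (omega1 c E) (omega3Im c E)) *
      (x - halfValue₃ (waveLattice h) (omega3Im c E)) =
      (x - (E - 1) / (3 * (c ^ 2 - 1))) * (x + (E + 2) / (6 * (c ^ 2 - 1))) *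
      (x - (4 - E) / (6 * (c ^ 2 - 1))) := by
  have ht := h.scale_pos
  obtain ⟨e1, e2, e3⟩ := h.isRectangular.half_eq h.modulus_sq.1 h.modulus_sq.2 ht
    (mul_div_cancel₀ _ ht.ne') (mul_div_cancel₀ _ ht.ne')
  rw [e1, e2, e3]
  have hd := h.sq_sub_one_ne_zero
  have hd' : 1 - c ^ 2 ≠ 0 := fun h0 => hd (by linarith)
  have hneg : (1 - c ^ 2) = -(c ^ 2 - 1) := by ring
  -- The same three roots occur in all four regions; only their order changes.
  rcases h with ⟨hc, hE⟩ | ⟨hc, hE⟩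
  · have hc' : c ^ 2 - 1 < 0 := by
      have := (sq_lt_one_iff_abs_lt_one c).2 hc
      linarith
    have hc'' : 0 < 1 - c ^ 2 := by linarith
    rw [abs_of_neg hc']
    by_cases hE0 : E < 0
    · have h2 : 0 < 2 - E := by linarith
      have hm : modulus c E ^ 2 = 2 / (2 - E) := by
        rw [modulus, if_pos hc, if_pos hE0, Real.sq_sqrt (by positivity)]
      have hs : scale c E ^ 2 = (2 - E) / (2 * (1 - c ^ 2)) := by
        rw [scale, if_pos hc, if_pos hE0, Real.sq_sqrt (by positivity)]
      rw [hm, hs, hneg]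
      refine ⟨?_, fun x => ?_⟩ <;> field_simp <;> ring
    · have hE1 := (hE.resolve_left hE0)
      have h2 : 0 < 2 - E := by linarith
      have hm : modulus c E ^ 2 = (2 - E) / 2 := by
        rw [modulus, if_pos hc, if_neg hE0, Real.sq_sqrt (by positivity)]
      have hs : scale c E ^ 2 = 1 / (1 - c ^ 2) := by
        rw [scale, if_pos hc, if_neg hE0, Real.sq_sqrt (by positivity)]
      rw [hm, hs, hneg]
      refine ⟨?_, fun x => ?_⟩ <;> field_simp <;> ring
  · have hc' : 0 < c ^ 2 - 1 := by
      have := (one_lt_sq_iff_one_lt_abs c).2 hc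
      linarith
    rw [abs_of_pos hc']
    by_cases hE0 : 2 < E
    · have h2 : 0 < E := by linarith
      have hm : modulus c E ^ 2 = 2 / E := by
        rw [modulus, if_neg (not_lt.2 hc.le), if_pos hE0, Real.sq_sqrt (by positivity)]
      have hs : scale c E ^ 2 = E / (2 * (c ^ 2 - 1)) := by
        rw [scale, if_neg (not_lt.2 hc.le), if_pos hE0, Real.sq_sqrt (by positivity)]
      rw [hm, hs]
      refine ⟨?_, fun x => ?_⟩ <;> field_simp <;> ring
    · have hE1 := (hE.resolve_right hE0)
      have h2 : 0 < E := by linarith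
      have hm : modulus c E ^ 2 = E / 2 := by
        rw [modulus, if_neg (not_lt.2 hc.le), if_neg hE0, Real.sq_sqrt (by positivity)]
      have hs : scale c E ^ 2 = 1 / (c ^ 2 - 1) := by
        rw [scale, if_neg (not_lt.2 hc.le), if_neg hE0, Real.sq_sqrt (by positivity)]
      rw [hm, hs]
      refine ⟨?_, fun x => ?_⟩ <;> field_simp <;> ring

lemma Admissible.lambdaOneIm_sq (h : Admissible c E) :
    lambdaOneIm c E ^ 2 = ((c ^ 2 - 1) * (E - 1) + |c ^ 2 - 1|) / 2 ∧ 0 < lambdaOneIm c E := by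
  rcases h with ⟨hc, hE⟩ | ⟨hc, hE⟩
  · have hc' : c ^ 2 - 1 < 0 := by
      have := (sq_lt_one_iff_abs_lt_one c).2 hc
      linarith
    have hE' : 0 < 2 - E := by rcases hE with hE | hE <;> linarith
    have hpos : 0 < (1 - c ^ 2) * (2 - E) / 2 := by
      have := mul_pos (show 0 < 1 - c ^ 2 by linarith) hE'
      linarith
    rw [lambdaOneIm, if_pos hc, abs_of_neg hc', Real.sq_sqrt hpos.le]
    exact ⟨by ring, Real.sqrt_pos.2 hpos⟩
  · have hc' : 0 < c ^ 2 - 1 := by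
      have := (one_lt_sq_iff_one_lt_abs c).2 hc
      linarith
    have hE' : 0 < E := by rcases hE with hE | hE <;> linarith
    have hpos : 0 < E * (c ^ 2 - 1) / 2 := by positivity
    rw [lambdaOneIm, if_neg (not_lt.2 hc.le), abs_of_pos hc', Real.sq_sqrt hpos.le]
    exact ⟨by ring, Real.sqrt_pos.2 hpos⟩

lemma omegaSq_ofReal (c E ζ : ℝ) : omegaSq c E ζ =
    ((-((8 * (c ^ 2 - 1) * (E - 1) + (c - 1) ^ 2 / ζ ^ 2 + 16 * (c + 1) ^ 2 * ζ ^ 2) / 64) : ℝ) : ℂ) := by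
  simp only [omegaSq]
  push_cast
  ring

/-- The arithmetic-geometric mean inequality for ((c - 1)/ζ)² and (4(c + 1)ζ)². -/
lemma Admissible.lambdaOneIm_sq_le (h : Admissible c E) {ζ : ℝ} (hζ : ζ ≠ 0) :
    lambdaOneIm c E ^ 2 ≤
      (8 * (c ^ 2 - 1) * (E - 1) + (c - 1) ^ 2 / ζ ^ 2 + 16 * (c + 1) ^ 2 * ζ ^ 2) / 16 := by
  rw [h.lambdaOneIm_sq.1]
  have h1 : 8 * |c ^ 2 - 1| ≤ (c - 1) ^ 2 / ζ ^ 2 + 16 * (c + 1) ^ 2 * ζ ^ 2 := by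
    have e1 : (c - 1) ^ 2 / ζ ^ 2 + 16 * (c + 1) ^ 2 * ζ ^ 2 - 8 * (c ^ 2 - 1) =
      ((c - 1) / ζ - 4 * (c + 1) * ζ) ^ 2 := by field_simp; ring
    have e2 : (c - 1) ^ 2 / ζ ^ 2 + 16 * (c + 1) ^ 2 * ζ ^ 2 + 8 * (c ^ 2 - 1) =
      ((c - 1) / ζ + 4 * (c + 1) * ζ) ^ 2 := by field_simp; ring
    rcases abs_cases (c ^ 2 - 1) with ⟨h2, -⟩ | ⟨h2, -⟩ <;> rw [h2]
    · linarith [sq_nonneg ((c - 1) / ζ - 4 * (c + 1) * ζ)]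
    · linarith [sq_nonneg ((c - 1) / ζ + 4 * (c + 1) * ζ)]
  linarith

/-- The frequencies `Ω(ζ)` for real `ζ` are purely imaginary. -/
lemma Admissible.omega_eq (h : Admissible c E) {ζ : ℝ} (hζ : ζ ≠ 0) {Ω : ℂ}
    (hΩ : Ω ^ 2 = omegaSq c E ζ) : Ω.re = 0 ∧ 64 * Ω.im ^ 2 =
      8 * (c ^ 2 - 1) * (E - 1) + (c - 1) ^ 2 / ζ ^ 2 + 16 * (c + 1) ^ 2 * ζ ^ 2 := by
  have h1 := h.lambdaOneIm_sq_le hζ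
  have h2 : 0 < lambdaOneIm c E ^ 2 := pow_pos h.lambdaOneIm_sq.2 2
  rw [omegaSq_ofReal] at hΩ
  have hre := congrArg re hΩ
  have him := congrArg im hΩ
  rw [sq, mul_re, ofReal_re] at hre
  rw [sq, mul_im, ofReal_im] at him
  have hz : Ω.re = 0 := by
    rcases mul_eq_zero.1 (show Ω.re * Ω.im = 0 by linarith) with h0 | h0
    · exact h0
    · rw [h0] at hre
      nlinarith [mul_self_nonneg Ω.re]
  refine ⟨hz, ?_⟩
  rw [hz] at hre
  linarith

/-- The value `-C₄ / C₅` for real `ζ` and `Ω = i w`. -/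
noncomputable def rhoValue (c E ζ w : ℝ) : ℝ :=
  -(E - 1) / (6 * (c ^ 2 - 1)) - (2 * (c + 1) * ζ ^ 2 + 4 * ζ * w) / ((c - 1) ^ 2 * (c + 1))

lemma Admissible.neg_C4_div_C5 (h : Admissible c E) {ζ : ℝ} (hζ : ζ ≠ 0) {Ω : ℂ} (hΩ : Ω.re = 0) :
    -C4 c E ζ Ω / C5 c ζ = rhoValue c E ζ Ω.im := by
  have hw : Ω = Ω.im * I := Complex.ext (by simp [hΩ]) (by simp)
  have h1 : (c : ℂ) - 1 ≠ 0 := by exact_mod_cast h.sub_one_ne_zero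
  have h2 : (c : ℂ) + 1 ≠ 0 := by exact_mod_cast h.add_one_ne_zero
  have h4 : (ζ : ℂ) ≠ 0 := by exact_mod_cast hζ
  have h5 : (c : ℂ) ^ 2 - 1 = (c - 1) * (c + 1) := by ring
  rw [hw, C4, C5, rhoValue]
  push_cast
  rw [show 24 * I * ζ * ((Ω.im : ℂ) * I) = -24 * ζ * Ω.im by linear_combination 24 * ζ * Ω.im * I_sq]
  simp only [mul_im, ofReal_im, ofReal_re, I_im, I_re, mul_one, mul_zero, add_zero]
  rw [h5]
  field_simp
  ring

lemma Admissible.rhoValue_cubic (h : Admissible c E) {ζ w : ℝ} (hζ : ζ ≠ 0)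
    (hw : 64 * w ^ 2 =
      8 * (c ^ 2 - 1) * (E - 1) + (c - 1) ^ 2 / ζ ^ 2 + 16 * (c + 1) ^ 2 * ζ ^ 2) :
    (rhoValue c E ζ w - (E - 1) / (3 * (c ^ 2 - 1))) *
      (rhoValue c E ζ w + (E + 2) / (6 * (c ^ 2 - 1))) *
      (rhoValue c E ζ w - (4 - E) / (6 * (c ^ 2 - 1))) ≤ 0 := by
  have h1 := h.sub_one_ne_zero
  have h2 := h.add_one_ne_zero
  have h5 : c ^ 2 - 1 = (c - 1) * (c + 1) := by ring
  have hw' : 64 * w ^ 2 * ζ ^ 2 = 8 * ((c - 1) * (c + 1)) * (E - 1) * ζ ^ 2 + (c - 1) ^ 2 +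
      16 * (c + 1) ^ 2 * ζ ^ 4 := by
    rw [hw]; field_simp; ring
  rw [rhoValue, h5]
  set p := c - 1
  set q := c + 1
  -- The square root on the right is, up to a factor ±i, the number N whose argument defines ν; so
  -- ℘'(ρ) = ±2N.
  have key : (-(E - 1) / (6 * (p * q)) - (2 * q * ζ ^ 2 + 4 * ζ * w) / (p ^ 2 * q) -
      (E - 1) / (3 * (p * q))) *
      (-(E - 1) / (6 * (p * q)) - (2 * q * ζ ^ 2 + 4 * ζ * w) / (p ^ 2 * q) +
      (E + 2) / (6 * (p * q))) *
      (-(E - 1) / (6 * (p * q)) - (2 * q * ζ ^ 2 + 4 * ζ * w) / (p ^ 2 * q) -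
      (4 - E) / (6 * (p * q))) =
      -(ζ * (2 * (2 * q * ζ ^ 2 + 4 * ζ * w) + p * (E - 1)) / (p ^ 3 * q)) ^ 2 := by
    field_simp
    linear_combination (-81 * (p * (E - 1) + 4 * q * ζ ^ 2 + 8 * ζ * w) : ℝ) * hw'
  rw [key]
  exact neg_nonpos.2 (sq_nonneg _)

end SineGordon

/-! ### The condition Re I = 0 and the values of 2Ω on the real axis. -/

namespace SineGordon

open Complex

variable {c E : ℝ}

lemma Admissible.rhoValue_le (h : Admissible c E) {ζ w : ℝ} (hζ : ζ ≠ 0)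
    (hw : 64 * w ^ 2 =
      8 * (c ^ 2 - 1) * (E - 1) + (c - 1) ^ 2 / ζ ^ 2 + 16 * (c + 1) ^ 2 * ζ ^ 2)
    (hpos : 0 < (c + 1) * ζ * w) :
    rhoValue c E ζ w ≤ halfValue₃ (waveLattice h) (omega3Im c E) := by
  have h1 := h.sub_one_ne_zero
  have h2 := h.add_one_ne_zero
  have hd := h.sq_sub_one_ne_zero
  rw [h.half_values.1, rhoValue]
  -- The first alternative holds in the rotational regions, the second in the librational ones.
  have hreg : 0 ≤ (c ^ 2 - 1) * (E - 1) ∨ (E - 1) ^ 2 ≤ 1 := by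
    rcases h with ⟨hc, hE | hE⟩ | ⟨hc, hE | hE⟩
    · have := (sq_lt_one_iff_abs_lt_one c).2 hc
      exact Or.inl (mul_nonneg_of_nonpos_of_nonpos (by linarith) (by linarith))
    · exact Or.inr (by nlinarith)
    · exact Or.inr (by nlinarith)
    · have := (one_lt_sq_iff_one_lt_abs c).2 hc
      exact Or.inl (mul_nonneg (by linarith) (by linarith))
  have hw' : 64 * w ^ 2 * ζ ^ 2 = 8 * (c ^ 2 - 1) * (E - 1) * ζ ^ 2 + (c - 1) ^ 2 +
      16 * (c + 1) ^ 2 * ζ ^ 4 := by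
    rw [hw]; field_simp
  set d := c ^ 2 - 1 with hd_def
  set m := (c + 1) ^ 2 * ζ ^ 2 with hm
  set Z := 2 * m + 4 * ((c + 1) * ζ * w) with hZ
  have hm0 : 0 < m := by positivity
  have hZm : 2 * m < Z := by linarith
  have hquad : 4 * Z ^ 2 - d ^ 2 = 8 * m * (2 * Z + d * (E - 1)) := by
    simp only [hZ, hm, hd_def] at hw' ⊢
    linear_combination (c + 1) ^ 2 * hw'
  have hdpos : 0 < |d| := abs_pos.2 hd
  -- This is P ≤ e₃ rewritten. If it failed, `hquad` would make 2Z + d(E - 1) negative, and 8m < 4Z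
  -- would give 4Z² + 4Zd(E - 1) + d² < 0. Either alternative of `hreg` excludes this, the second by
  -- completing the square.
  have hZd : |d| / 2 ≤ Z := by
    by_contra! hlt
    have h4 : 4 * Z ^ 2 < d ^ 2 := by rw [← sq_abs d]; nlinarith
    have h5 : 2 * Z + d * (E - 1) < 0 := by
      by_contra! h6
      nlinarith [mul_nonneg hm0.le h6]
    have h7 : 4 * Z ^ 2 + 4 * Z * (d * (E - 1)) + d ^ 2 < 0 := by
      nlinarith [mul_neg_of_pos_of_neg (show 0 < 4 * Z - 8 * m by linarith) h5]
    rcases hreg with h8 | h8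
    · nlinarith
    · nlinarith [sq_nonneg (2 * Z + d * (E - 1)), mul_nonneg (sq_nonneg d) (sub_nonneg.2 h8)]
  have e1 : (2 * (c + 1) * ζ ^ 2 + 4 * ζ * w) / ((c - 1) ^ 2 * (c + 1)) = Z / d ^ 2 := by
    have : d ^ 2 = (c - 1) ^ 2 * (c + 1) ^ 2 := by rw [hd_def]; ring
    rw [this, hZ, hm]
    field_simp
  rw [e1]
  have e2 : 1 / (2 * |d|) ≤ Z / d ^ 2 := by
    rw [← sq_abs d, div_le_div_iff₀ (by positivity) (by positivity)]
    nlinarith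
  linarith

lemma nu_im (c E : ℝ) (ζ Ω : ℂ) : (nu c E ζ Ω).im = 0 := by
  simp only [nu]
  split_ifs <;> simp

/-- Of ν only its being real matters, since the bracket it multiplies is imaginary. -/
lemma Admissible.laxI_re (h : Admissible c E) {ζ : ℝ} (hζ : ζ ≠ 0) {Ω ρ : ℂ}
    (hΩ : Ω ^ 2 = omegaSq c E ζ) (hρ : IsRho h ζ Ω ρ) : (laxI h ζ Ω ρ).re = 0 := by
  obtain ⟨hre, him⟩ := h.omega_eq hζ hΩ
  have hcub := h.rhoValue_cubic hζ him
  rw [← h.half_values.2] at hcub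
  have hP := hρ.2
  rw [h.neg_C4_div_C5 hζ hre] at hP
  have key := h.isRectangular.re_weierstrassZeta_sub_eq_zero hρ.1
    (h.isRectangular.add_conj_mem_of_weierstrassP_eq hρ.1 hP hcub)
  have h1 : 2 * (omega1 c E : ℂ) * (I * ζ + Ω) / (c - 1) =
      ((2 * omega1 c E * (ζ + Ω.im) / (c - 1) : ℝ) : ℂ) * I := by
    have hw : Ω = Ω.im * I := Complex.ext (by simp [hre]) (by simp)
    conv_lhs => rw [hw]
    push_cast
    ring
  rw [laxI, h1, add_re, mul_re _ (_ - _), key, re_ofReal_mul]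
  simp [nu_im]

theorem Admissible.lax_condition (h : Admissible c E) {ζ : ℝ} (hζ : ζ ≠ 0) {Ω : ℂ}
    (hΩ : Ω ^ 2 = omegaSq c E ζ) :
    Ω.re = 0 ∧ (∃ ρ : ℂ, IsRho h ζ Ω ρ) ∧ (∀ ρ : ℂ, IsRho h ζ Ω ρ → (laxI h ζ Ω ρ).re = 0) ∧
      (0 < (c + 1) * ζ * Ω.im → ∃ ρ : ℂ, IsRho h ζ Ω ρ ∧ ρ.re = 0 ∧
        (weierstrassZeta (waveLattice h) ρ).re = 0) := by
  obtain ⟨hre, him⟩ := h.omega_eq hζ hΩ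
  have hcub := h.rhoValue_cubic hζ him
  rw [← h.half_values.2] at hcub
  refine ⟨hre, ?_, fun ρ => h.laxI_re hζ hΩ, fun hpos => ?_⟩
  · obtain ⟨ρ, h1, h2⟩ := h.isRectangular.exists_weierstrassP_eq hcub
    exact ⟨ρ, h1, by rw [h2, h.neg_C4_div_C5 hζ hre]⟩
  · obtain ⟨ρ, h1, h2, h3, h4⟩ := h.isRectangular.exists_imaginary (h.rhoValue_le hζ him hpos)
    exact ⟨ρ, ⟨h1, by rw [h2, h.neg_C4_div_C5 hζ hre]⟩, h3, h4⟩

/-- The numbers `2 Ω(ζ)` for real `ζ` fill the two rays. -/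
theorem Admissible.omega_values (h : Admissible c E) :
    {μ : ℂ | ∃ ζ : ℝ, ζ ≠ 0 ∧ ∃ Ω : ℂ, Ω ^ 2 = omegaSq c E ζ ∧ μ = 2 * Ω} = imaginaryRays c E := by
  obtain ⟨hl2, hl0⟩ := h.lambdaOneIm_sq
  ext μ
  constructor
  · rintro ⟨ζ, hζ, Ω, hΩ, rfl⟩
    obtain ⟨hre, him⟩ := h.omega_eq hζ hΩ
    have h1 := h.lambdaOneIm_sq_le hζ
    refine ⟨2 * Ω.im, ?_, Complex.ext (by simp [hre]) (by simp)⟩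
    have h2 : lambdaOneIm c E ≤ |2 * Ω.im| := abs_le_of_sq_le_sq' (by rw [sq_abs]; linarith)
      (abs_nonneg _) |>.2
    rcases le_abs.1 h2 with h3 | h3
    · exact Or.inr h3
    · exact Or.inl (by linarith)
  · rintro ⟨t, ht, rfl⟩
    have ht2 : lambdaOneIm c E ^ 2 ≤ t ^ 2 := by
      rcases ht with ht | ht <;> nlinarith
    have hq := h.add_one_ne_zero
    have hp := h.sub_one_ne_zero
    set T := 16 * t ^ 2 - 8 * (c ^ 2 - 1) * (E - 1) with hT
    have hTd : 8 * |c ^ 2 - 1| ≤ T := by linarith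
    have hd : 0 < |c ^ 2 - 1| := abs_pos.2 h.sq_sub_one_ne_zero
    have hD : 0 ≤ T ^ 2 - 64 * ((c - 1) * (c + 1)) ^ 2 := by
      rw [show (c - 1) * (c + 1) = c ^ 2 - 1 by ring, ← sq_abs (c ^ 2 - 1)]
      nlinarith
    have hR := Real.sq_sqrt hD
    have hR0 := Real.sqrt_nonneg (T ^ 2 - 64 * ((c - 1) * (c + 1)) ^ 2)
    set R := √(T ^ 2 - 64 * ((c - 1) * (c + 1)) ^ 2)
    -- The unknown x stands for ζ². The witness is the larger root, and T ≥ 8|d| makes both the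
    -- discriminant nonnegative and the root positive.
    obtain ⟨x, hx0, hxq⟩ : ∃ x : ℝ, 0 < x ∧ 16 * (c + 1) ^ 2 * x ^ 2 -
        (16 * t ^ 2 - 8 * (c ^ 2 - 1) * (E - 1)) * x + (c - 1) ^ 2 = 0 := by
      have : 0 < T + R := by linarith
      refine ⟨(T + R) / (32 * (c + 1) ^ 2), by positivity, ?_⟩
      rw [← hT]
      field_simp
      linear_combination 16 * hR
    have hs : √x ^ 2 = x := Real.sq_sqrt hx0.le
    refine ⟨√x, (Real.sqrt_pos.2 hx0).ne', (t / 2 : ℝ) * I, ?_, by push_cast; ring⟩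
    rw [omegaSq_ofReal, hs, mul_pow, I_sq]
    have : (8 * (c ^ 2 - 1) * (E - 1) + (c - 1) ^ 2 / x + 16 * (c + 1) ^ 2 * x) / 64 =
        (t / 2) ^ 2 := by
      field_simp
      linear_combination 4 * hxq
    rw [this]
    push_cast
    ring

end SineGordon

/-! ### Linear differential equations and the Lax spectrum. -/

namespace SineGordon

open MeasureTheory Set

section LinearODE

variable {V : Type*} [NormedAddCommGroup V] [NormedSpace ℝ V]

/-- The iterated integrals in the Dyson series of the linear equation `u' = A u`. -/
noncomputable def dysonTerm (A : ℝ → V →L[ℝ] V) (x : V) : ℕ → ℝ → V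
  | 0 => fun _ => x
  | n + 1 => fun t => ∫ s in (0 : ℝ)..t, A s (dysonTerm A x n s)

/-- The derivatives of the terms of the Dyson series. -/
noncomputable def dysonTermDeriv (A : ℝ → V →L[ℝ] V) (x : V) : ℕ → ℝ → V
  | 0 => fun _ => 0
  | n + 1 => fun t => A t (dysonTerm A x n t)

variable {A : ℝ → V →L[ℝ] V}

lemma dysonTerm_bound (x : V) {K T : ℝ} (hK : ∀ t ∈ Icc (-T) T, ‖A t‖ ≤ K) (hK0 : 0 ≤ K) (n : ℕ)
    {t : ℝ} (ht : t ∈ Icc (-T) T) : ‖dysonTerm A x n t‖ ≤ ‖x‖ * (K * |t|) ^ n / n.factorial := by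
  induction n generalizing t with
  | zero => simp [dysonTerm]
  | succ n ih =>
    have hT : 0 ≤ T := by linarith [ht.1, ht.2]
    have hsub : ∀ s ∈ uIoc 0 t, s ∈ Icc (-T) T := fun s hs =>
      (uIcc_subset_Icc (by constructor <;> linarith) ht) (uIoc_subset_uIcc hs)
    have hcont : Continuous fun s : ℝ => K * (‖x‖ * K ^ n / n.factorial) * |s - 0| ^ n := by
      fun_prop
    calc ‖dysonTerm A x (n + 1) t‖ ≤ ∫ s in uIoc 0 t, ‖A s (dysonTerm A x n s)‖ :=
          intervalIntegral.norm_integral_le_integral_norm_uIoc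
      _ ≤ ∫ s in uIoc 0 t, K * (‖x‖ * K ^ n / n.factorial) * |s - 0| ^ n := by
          refine integral_mono_of_nonneg (Filter.Eventually.of_forall fun s => norm_nonneg _)
            (hcont.integrableOn_uIoc) ?_
          refine (ae_restrict_iff' measurableSet_uIoc).2 (Filter.Eventually.of_forall fun s hs => ?_)
          calc ‖A s (dysonTerm A x n s)‖ ≤ ‖A s‖ * ‖dysonTerm A x n s‖ := (A s).le_opNorm _
            _ ≤ K * (‖x‖ * (K * |s|) ^ n / n.factorial) := by
                gcongr
                exacts [hK s (hsub s hs), ih (hsub s hs)]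
            _ = K * (‖x‖ * K ^ n / n.factorial) * |s - 0| ^ n := by rw [sub_zero, mul_pow]; ring
      _ = ‖x‖ * (K * |t|) ^ (n + 1) / (n + 1).factorial := by
          rw [integral_const_mul, integral_pow_abs_sub_uIoc, sub_zero, Nat.factorial_succ, mul_pow]
          push_cast
          field_simp
          ring

variable [CompleteSpace V]

lemma hasDerivAt_dysonTerm (hA : Continuous A) (x : V) (n : ℕ) (t : ℝ) :
    HasDerivAt (dysonTerm A x n) (dysonTermDeriv A x n t) t := by
  induction n generalizing t with
  | zero => exact hasDerivAt_const t x
  | succ n ih =>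
    have hc : Continuous (dysonTerm A x n) := continuous_iff_continuousAt.2 fun t =>
      (ih t).continuousAt
    have hc' : Continuous fun s => A s (dysonTerm A x n s) := hA.clm_apply hc
    exact intervalIntegral.integral_hasDerivAt_right (hc'.intervalIntegrable _ _)
      hc'.aestronglyMeasurable.stronglyMeasurableAtFilter hc'.continuousAt

/-- Global existence for linear equations with continuous coefficients. -/
theorem exists_hasDerivAt_linear (hA : Continuous A) (x : V) :
    ∃ u : ℝ → V, u 0 = x ∧ ∀ t, HasDerivAt u (A t (u t)) t := by
  have hbound : ∀ T : ℝ, ∃ K, 0 ≤ K ∧ ∀ t ∈ Icc (-T) T, ‖A t‖ ≤ K := by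
    intro T
    obtain ⟨K, hK⟩ := isCompact_Icc.exists_bound_of_continuousOn (hA.continuousOn (s := Icc (-T) T))
    exact ⟨max K 0, le_max_right _ _, fun t ht => (hK t ht).trans (le_max_left _ _)⟩
  have hsum : ∀ t, Summable fun n => dysonTerm A x n t := by
    intro t
    obtain ⟨K, hK0, hK⟩ := hbound |t|
    refine .of_norm_bounded (g := fun n => ‖x‖ * ((K * |t|) ^ n / n.factorial))
      ((Real.summable_pow_div_factorial _).mul_left _) fun n => ?_
    rw [← mul_div_assoc]
    exact dysonTerm_bound x hK hK0 n ⟨neg_abs_le t, le_abs_self t⟩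
  refine ⟨fun t => ∑' n, dysonTerm A x n t, ?_, fun t => ?_⟩
  · dsimp only
    rw [tsum_eq_single 0 fun n hn => ?_]
    · rfl
    · obtain ⟨m, rfl⟩ := Nat.exists_eq_succ_of_ne_zero hn
      simp [dysonTerm]
  · set T := |t| + 1 with hT
    obtain ⟨K, hK0, hK⟩ := hbound T
    have htT : t ∈ Ioo (-T) T := by
      constructor <;> [linarith [neg_abs_le t]; linarith [le_abs_self t]]
    have hTpos : 0 ≤ T := by positivity
    have hd := hasDerivAt_tsum_of_isPreconnected
      -- The majorant is shifted by one index, since the derivative of term n + 1 is A applied to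
      -- term n; it is 0 at index 0, where the term is constant.
      (u := fun n => Nat.casesOn n 0 fun n => K * (‖x‖ * ((K * T) ^ n / n.factorial)))
      (g := dysonTerm A x) (g' := dysonTermDeriv A x) (t := Ioo (-T) T) (y₀ := t) (y := t)
      ?_ isOpen_Ioo isPreconnected_Ioo (fun n y _ => hasDerivAt_dysonTerm hA x n y) ?_ htT (hsum t)
      htT
    · convert! hd using 1
      have hs := (hsum t).mapL (A t)
      rw [(A t).map_tsum (hsum t)]
      rw [((summable_nat_add_iff (f := fun n => dysonTermDeriv A x n t) 1).1 hs).tsum_eq_zero_add]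
      simp [dysonTermDeriv]
    · exact (summable_nat_add_iff (f := fun n => (Nat.casesOn n 0
        fun n => K * (‖x‖ * ((K * T) ^ n / n.factorial)) : ℝ)) 1).1
        (((Real.summable_pow_div_factorial _).mul_left _).mul_left _)
    · intro n y hy
      cases n with
      | zero => simp [dysonTermDeriv]
      | succ n =>
        have hy' : y ∈ Icc (-T) T := Ioo_subset_Icc_self hy
        calc ‖A y (dysonTerm A x n y)‖ ≤ ‖A y‖ * ‖dysonTerm A x n y‖ := (A y).le_opNorm _
          _ ≤ K * (‖x‖ * (K * |y|) ^ n / n.factorial) := by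
              gcongr
              exacts [hK y hy', dysonTerm_bound x hK hK0 n hy']
          _ ≤ K * (‖x‖ * ((K * T) ^ n / n.factorial)) := by
              rw [mul_div_assoc]
              gcongr
              exact abs_le.2 hy'

end LinearODE

open Complex ComplexConjugate

/-- For skew-hermitian coefficients, the `2 × 2` linear system has a bounded solution. -/
lemma exists_bounded_solution {C D D' : ℝ → ℂ} (hC : Continuous C) (hD : Continuous D)
    (hD' : Continuous D') (hC' : ∀ z, conj (C z) = -C z) (hDD' : ∀ z, conj (D z) = -D' z) :
    ∃ χ₁ χ₂ : ℝ → ℂ, (∀ z, HasDerivAt χ₁ (C z * χ₁ z + D z * χ₂ z) z) ∧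
      (∀ z, HasDerivAt χ₂ (D' z * χ₁ z - C z * χ₂ z) z) ∧
      (∃ z, χ₁ z ≠ 0 ∨ χ₂ z ≠ 0) ∧ ∃ M : ℝ, ∀ z, ‖χ₁ z‖ ≤ M ∧ ‖χ₂ z‖ ≤ M := by
  let p₁ := ContinuousLinearMap.fst ℝ ℂ ℂ
  let p₂ := ContinuousLinearMap.snd ℝ ℂ ℂ
  let A : ℝ → ℂ × ℂ →L[ℝ] ℂ × ℂ := fun z => C z • p₁.prod 0 + D z • p₂.prod 0 +
    (D' z • ContinuousLinearMap.prod 0 p₁ - C z • ContinuousLinearMap.prod 0 p₂)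
  have hA : Continuous A := by fun_prop
  obtain ⟨u, hu0, hu⟩ := exists_hasDerivAt_linear hA ((1, 0) : ℂ × ℂ)
  have h1 : ∀ z, HasDerivAt (fun z => (u z).1) (C z * (u z).1 + D z * (u z).2) z := fun z => by
    simpa [A, p₁, p₂, Function.comp_def] using p₁.hasFDerivAt.comp_hasDerivAt z (hu z)
  have h2 : ∀ z, HasDerivAt (fun z => (u z).2) (D' z * (u z).1 - C z * (u z).2) z := fun z => by
    simpa [A, p₁, p₂, Function.comp_def] using p₂.hasFDerivAt.comp_hasDerivAt z (hu z)
  -- A skew-hermitian coefficient matrix conserves the hermitian norm.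
  have hN : ∀ z, HasDerivAt (fun z => (u z).1 * conj (u z).1 + (u z).2 * conj (u z).2) 0 z := by
    intro z
    have c1 : HasDerivAt (fun z => conj (u z).1) _ z := (h1 z).star
    have c2 : HasDerivAt (fun z => conj (u z).2) _ z := (h2 z).star
    have hd2 : conj (D' z) = -D z := by rw [← neg_eq_iff_eq_neg.2 (hDD' z)]; simp
    convert! ((h1 z).mul c1).add ((h2 z).mul c2) using 1
    simp only [star_def, map_add, map_sub, map_mul, hC' z, hDD' z, hd2]
    ring
  have hconst : ∀ z, (u z).1 * conj (u z).1 + (u z).2 * conj (u z).2 = 1 := by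
    intro z
    have := is_const_of_deriv_eq_zero (fun z => (hN z).differentiableAt) (fun z => (hN z).deriv) z 0
    simpa [hu0] using this
  have hnorm : ∀ z, ‖(u z).1‖ ^ 2 + ‖(u z).2‖ ^ 2 = 1 := by
    intro z
    have := hconst z
    rw [mul_conj', mul_conj'] at this
    exact_mod_cast this
  refine ⟨fun z => (u z).1, fun z => (u z).2, h1, h2, ⟨0, Or.inl (by simp [hu0])⟩, 1, fun z => ?_⟩
  constructor <;> nlinarith [hnorm z, sq_nonneg ‖(u z).1‖, sq_nonneg ‖(u z).2‖,
    norm_nonneg (u z).1, norm_nonneg (u z).2]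

theorem IsWave.mem_laxSpectrum {c E : ℝ} {f : ℝ → ℝ} (hf : IsWave c E f) {ζ : ℝ} (hζ : ζ ≠ 0) :
    (ζ : ℂ) ∈ laxSpectrum c f := by
  have hc : Continuous f := hf.contDiff.continuous
  have hc' : Continuous (deriv f) := hf.contDiff.continuous_deriv (by norm_num)
  refine ⟨by exact_mod_cast hζ, exists_bounded_solution ?_ ?_ ?_ ?_ ?_⟩
  · unfold laxC; fun_prop
  · unfold laxD; fun_prop
  · unfold laxD'; fun_prop
  · intro z
    simp only [laxC, map_add, map_neg, map_mul, map_div₀, conj_I, conj_ofReal, map_ofNat]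
    ring
  · intro z
    simp only [laxD, laxD', map_add, map_sub, map_mul, map_div₀, conj_I, conj_ofReal, map_ofNat]
    ring

end SineGordon

/-! ### From the Lamé equation to the stability spectrum. -/

namespace SineGordon

open Set

open Complex

/-- If `G > 0` solves `2 G G'' - G'² + 4 Q G² = 4 m²`, then `√G exp (i ∫ m / G)` solves
`V'' = - Q V`. -/
lemma exists_bounded_of_product {G G' G'' Q : ℝ → ℝ} {m B : ℝ} (hG : ∀ z, 0 < G z)
    (hB : ∀ z, G z ≤ B) (h1 : ∀ z, HasDerivAt G (G' z) z) (h2 : ∀ z, HasDerivAt G' (G'' z) z)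
    (hQ : ∀ z, 2 * G z * G'' z - G' z ^ 2 + 4 * Q z * G z ^ 2 = 4 * m ^ 2) :
    ∃ V V' : ℝ → ℂ, (∀ z, HasDerivAt V (V' z) z) ∧ (∀ z, HasDerivAt V' (-(Q z * V z)) z) ∧
      V 0 ≠ 0 ∧ ∃ M : ℝ, ∀ z, ‖V z‖ ≤ M := by
  have hcG : Continuous G := continuous_iff_continuousAt.2 fun z => (h1 z).continuousAt
  have hc : Continuous fun z => m / G z := continuous_const.div hcG fun z => (hG z).ne'
  set θ : ℝ → ℝ := fun z => ∫ y in (0 : ℝ)..z, m / G y with hθ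
  have hθd : ∀ z, HasDerivAt θ (m / G z) z := fun z =>
    intervalIntegral.integral_hasDerivAt_right (hc.intervalIntegrable _ _)
      hc.aestronglyMeasurable.stronglyMeasurableAtFilter hc.continuousAt
  set V : ℝ → ℂ := fun z => (√(G z) : ℝ) * exp ((θ z : ℝ) * I) with hV
  -- The logarithmic derivative of V. The hypothesis on G is the Riccati equation s' + s² = -Q.
  set s : ℝ → ℂ := fun z => ((G' z : ℝ) / 2 + m * I) / (G z : ℝ) with hs
  have hVd : ∀ z, HasDerivAt V (V z * s z) z := by
    intro z
    have a1 := ((h1 z).sqrt (hG z).ne').ofReal_comp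
    have a2 := (((hθd z).ofReal_comp).mul_const I).cexp
    convert! a1.mul a2 using 1
    have hr : (√(G z) : ℂ) ≠ 0 := by exact_mod_cast (Real.sqrt_pos.2 (hG z)).ne'
    have hr2 : (√(G z) : ℂ) ^ 2 = (G z : ℂ) := by exact_mod_cast Real.sq_sqrt (hG z).le
    simp only [hV, hs]
    push_cast
    rw [← hr2]
    field_simp
  have hsd : ∀ z, HasDerivAt s
      (((G'' z : ℝ) / 2 * (G z : ℝ) - ((G' z : ℝ) / 2 + m * I) * (G' z : ℝ)) / (G z : ℝ) ^ 2) z := by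
    intro z
    have hz : (G z : ℂ) ≠ 0 := by exact_mod_cast (hG z).ne'
    exact ((((h2 z).ofReal_comp).div_const 2).add_const (m * I : ℂ)).div (h1 z).ofReal_comp hz
  refine ⟨V, fun z => V z * s z, hVd, fun z => ?_, ?_, √B, fun z => ?_⟩
  · convert! (hVd z).mul (hsd z) using 1
    have hz : (G z : ℂ) ≠ 0 := by exact_mod_cast (hG z).ne'
    have hq : 2 * (G z : ℂ) * G'' z - (G' z : ℂ) ^ 2 + 4 * Q z * (G z : ℂ) ^ 2 = 4 * (m : ℂ) ^ 2 := by
      exact_mod_cast hQ z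
    simp only [hs]
    field_simp
    linear_combination -V z * hq - 4 * V z * m ^ 2 * I_sq
  · have : (√(G 0) : ℂ) ≠ 0 := by exact_mod_cast (Real.sqrt_pos.2 (hG 0)).ne'
    exact mul_ne_zero this (exp_ne_zero _)
  · simp only [hV]
    rw [norm_mul, norm_exp_ofReal_mul_I, mul_one, norm_real, Real.norm_of_nonneg (Real.sqrt_nonneg _)]
    exact Real.sqrt_le_sqrt (hB z)

lemma contDiff_two_of_hasDerivAt {W W' W'' : ℝ → ℂ} (h1 : ∀ z, HasDerivAt W (W' z) z)
    (h2 : ∀ z, HasDerivAt W' (W'' z) z) (hc : Continuous W'') : ContDiff ℝ 2 W := by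
  have e1 : deriv W = W' := funext fun z => (h1 z).deriv
  have e2 : deriv W' = W'' := funext fun z => (h2 z).deriv
  rw [show (2 : WithTop ℕ∞) = 1 + 1 by norm_num, contDiff_succ_iff_deriv]
  refine ⟨fun z => (h1 z).differentiableAt, by simp, ?_⟩
  rw [e1, contDiff_one_iff_deriv, e2]
  exact ⟨fun z => (h2 z).differentiableAt, hc⟩

/-- Bounded solutions of the Lamé equation `d V'' + (cos f + t² / d) V = 0`, `d = c² - 1`,
give points `i t` of the stability spectrum. -/
lemma mem_stabilitySpectrum_of_lame {c t : ℝ} {f : ℝ → ℝ} (hd : c ^ 2 - 1 ≠ 0) (hf : Continuous f)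
    {V V' : ℝ → ℂ} (h1 : ∀ z, HasDerivAt V (V' z) z)
    (h2 : ∀ z, HasDerivAt V'
      (-(((Real.cos (f z) + t ^ 2 / (c ^ 2 - 1)) / (c ^ 2 - 1) : ℝ) * V z)) z)
    (hne : ∃ z, V z ≠ 0) (hb : ∃ M : ℝ, ∀ z, ‖V z‖ ≤ M) :
    (t * I : ℂ) ∈ stabilitySpectrum c f := by
  have hdc : (c : ℂ) ^ 2 - 1 ≠ 0 := by exact_mod_cast hd
  -- This κ removes the first-order term of dW'' - 2ictW' + (cos f - t²)W = 0 when W = exp(κz)V.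
  -- Being imaginary, it preserves boundedness.
  set κ : ℂ := ((c * t / (c ^ 2 - 1) : ℝ) : ℂ) * I with hκ
  set e : ℝ → ℂ := fun z => exp (κ * z) with he
  have hed : ∀ z, HasDerivAt e (κ * e z) z := by
    intro z
    have := (((hasDerivAt_id z).ofReal_comp).const_mul κ).cexp
    convert! this using 1
    simp [he, mul_comm]
  have henorm : ∀ z, ‖e z‖ = 1 := by
    intro z
    have : κ * z = ((c * t / (c ^ 2 - 1) * z : ℝ) : ℂ) * I := by rw [hκ]; push_cast; ring
    simp only [he]
    rw [this, norm_exp_ofReal_mul_I]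
  set q : ℝ → ℂ := fun z => (((Real.cos (f z) + t ^ 2 / (c ^ 2 - 1)) / (c ^ 2 - 1) : ℝ) : ℂ) with hq
  set W : ℝ → ℂ := fun z => e z * V z with hW
  set W' : ℝ → ℂ := fun z => e z * (κ * V z + V' z) with hW'
  set W'' : ℝ → ℂ := fun z => e z * (κ ^ 2 * V z + 2 * κ * V' z - q z * V z) with hW''
  have w1 : ∀ z, HasDerivAt W (W' z) z := by
    intro z
    convert! (hed z).mul (h1 z) using 1
    simp only [hW']
    ring
  have w2 : ∀ z, HasDerivAt W' (W'' z) z := by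
    intro z
    convert! (hed z).mul (((h1 z).const_mul κ).add (h2 z)) using 1
    simp only [hW'', hq, Pi.add_apply]
    ring
  have cV : Continuous V := continuous_iff_continuousAt.2 fun z => (h1 z).continuousAt
  have cV' : Continuous V' := continuous_iff_continuousAt.2 fun z => (h2 z).continuousAt
  have ce : Continuous e := continuous_iff_continuousAt.2 fun z => (hed z).continuousAt
  have cq : Continuous q := by
    refine continuous_ofReal.comp ?_
    fun_prop
  have hW2 : ContDiff ℝ 2 W := contDiff_two_of_hasDerivAt w1 w2 (by fun_prop)
  have e1 : deriv W = W' := funext fun z => (w1 z).deriv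
  have e2 : deriv W' = W'' := funext fun z => (w2 z).deriv
  have e3 : deriv (fun z => t * I * W z) = fun z => t * I * W' z :=
    funext fun z => ((w1 z).const_mul (t * I : ℂ)).deriv
  obtain ⟨z₀, hz₀⟩ := hne
  obtain ⟨M, hM⟩ := hb
  refine ⟨W, fun z => t * I * W z, hW2, contDiff_const.mul (hW2.of_le (by norm_num)), fun z => rfl,
    fun z => ?_, ⟨z₀, Or.inl (mul_ne_zero (exp_ne_zero _) hz₀)⟩, max M (|t| * M), fun z => ?_⟩
  · rw [e1, e2, e3]
    simp only [hW, hW', hW'', hq, hκ]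
    push_cast
    field_simp
    ring_nf
    simp only [I_sq]
    ring
  · have hn : ‖W z‖ ≤ M := by
      simp only [hW]
      rw [norm_mul, henorm, one_mul]
      exact hM z
    refine ⟨hn.trans (le_max_left _ _), le_trans ?_ (le_max_right _ _)⟩
    rw [norm_mul, norm_mul, norm_I, mul_one, norm_real, Real.norm_eq_abs]
    gcongr

end SineGordon

/-! ### Bounded solutions of the Lamé equation along a wave. -/

namespace SineGordon

open Set

open Complex

variable {c E : ℝ} {f : ℝ → ℝ}

namespace IsWave

lemma hasDerivAt (hf : IsWave c E f) (z : ℝ) : HasDerivAt f (deriv f z) z :=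
  (hf.contDiff.differentiable (by norm_num) z).hasDerivAt

lemma hasDerivAt_deriv (hf : IsWave c E f) (hd : c ^ 2 - 1 ≠ 0) (z : ℝ) :
    HasDerivAt (deriv f) (-Real.sin (f z) / (c ^ 2 - 1)) z := by
  have h1 : ContDiff ℝ 1 (deriv f) := by
    have h0 : ContDiff ℝ (1 + 1) f := by rw [one_add_one_eq_two]; exact hf.contDiff
    exact h0.deriv'
  have h2 := (h1.differentiable (by norm_num) z).hasDerivAt
  have h3 : deriv (deriv f) z = -Real.sin (f z) / (c ^ 2 - 1) := by
    rw [eq_div_iff hd]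
    linarith [hf.pendulum z]
  rwa [h3] at h2

lemma deriv_sq (hf : IsWave c E f) (hd : c ^ 2 - 1 ≠ 0) (z : ℝ) :
    deriv f z ^ 2 = 2 * (E - 1 + Real.cos (f z)) / (c ^ 2 - 1) := by
  rw [eq_div_iff hd]
  linarith [hf.energy z]

/-- Off the band edges the product of two Hermite solutions of the Lamé equation is
`σ (cos f + q)`, with a sign `σ` and `q = E - 1 - 2 τ`. -/
lemma lame_of_pos (hf : IsWave c E f) (hd : c ^ 2 - 1 ≠ 0) {τ σ : ℝ} (hσ : σ ^ 2 = 1)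
    (hpos : ∀ z, 0 < σ * (Real.cos (f z) + (E - 1 - 2 * τ)))
    (hM : 0 ≤ τ / (c ^ 2 - 1) * ((E - 1 - 2 * τ) ^ 2 - 1)) :
    ∃ V V' : ℝ → ℂ, (∀ z, HasDerivAt V (V' z) z) ∧
      (∀ z, HasDerivAt V' (-(((Real.cos (f z) + τ) / (c ^ 2 - 1) : ℝ) * V z)) z) ∧
      V 0 ≠ 0 ∧ ∃ M : ℝ, ∀ z, ‖V z‖ ≤ M := by
  -- The shift E - 1 - 2τ is the one for which cos f + q solves G''' + 4QG' + 2Q'G = 0, the equation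
  -- for products of solutions of V'' = -QV; m² is the resulting first integral.
  refine exists_bounded_of_product (G := fun z => σ * (Real.cos (f z) + (E - 1 - 2 * τ)))
    (G' := fun z => σ * (-Real.sin (f z) * deriv f z))
    (G'' := fun z => σ * (1 - 2 * (E - 1) * Real.cos (f z) - 3 * Real.cos (f z) ^ 2) / (c ^ 2 - 1))
    (m := √(τ / (c ^ 2 - 1) * ((E - 1 - 2 * τ) ^ 2 - 1)))
    (B := |σ| * (1 + |E - 1 - 2 * τ|)) hpos (fun z => ?_) (fun z => ?_) (fun z => ?_) fun z => ?_
  · calc σ * (Real.cos (f z) + (E - 1 - 2 * τ)) ≤ |σ * (Real.cos (f z) + (E - 1 - 2 * τ))| :=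
          le_abs_self _
      _ = |σ| * |Real.cos (f z) + (E - 1 - 2 * τ)| := abs_mul _ _
      _ ≤ |σ| * (1 + |E - 1 - 2 * τ|) := by
          gcongr
          exact (abs_add_le _ _).trans (by gcongr; exact Real.abs_cos_le_one _)
  · exact ((hf.hasDerivAt z).cos.add_const _).const_mul σ
  · convert! (((hf.hasDerivAt z).sin.neg).mul (hf.hasDerivAt_deriv hd z)).const_mul σ using 1
    have h1 := hf.deriv_sq hd z
    have h2 := Real.sin_sq_add_cos_sq (f z)
    rw [eq_div_iff hd] at h1
    simp only [Pi.neg_apply]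
    field_simp
    linear_combination σ * Real.cos (f z) * h1 - σ * h2
  · have h1 := hf.deriv_sq hd z
    have h2 := Real.sin_sq_add_cos_sq (f z)
    have h3 : Real.sin (f z) ^ 2 = 1 - Real.cos (f z) ^ 2 := by linarith
    rw [Real.sq_sqrt hM, mul_pow σ, mul_pow (-Real.sin (f z)), neg_sq, h1, h3]
    field_simp
    have h4 : σ * σ = 1 := by rw [← sq, hσ]
    ring_nf
    simp only [hσ]
    ring

/-- The band edge solution `sin (f / 2)` of the Lamé equation. -/
lemma lame_sin (hf : IsWave c E f) (hd : c ^ 2 - 1 ≠ 0) :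
    ∃ V V' : ℝ → ℝ, (∀ z, HasDerivAt V (V' z) z) ∧
      (∀ z, HasDerivAt V' (-((Real.cos (f z) + E / 2) / (c ^ 2 - 1) * V z)) z) ∧
      V = fun z => Real.sin (f z / 2) := by
  refine ⟨fun z => Real.sin (f z / 2), fun z => Real.cos (f z / 2) * (deriv f z / 2),
    fun z => ((hf.hasDerivAt z).div_const 2).sin, fun z => ?_, rfl⟩
  convert! (((hf.hasDerivAt z).div_const 2).cos).mul
    ((hf.hasDerivAt_deriv hd z).div_const 2) using 1
  have h1 := hf.deriv_sq hd z
  have h2 := Real.sin_sq_add_cos_sq (f z / 2)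
  have h3 : Real.sin (f z) = 2 * Real.sin (f z / 2) * Real.cos (f z / 2) := by
    rw [← Real.sin_two_mul]; ring_nf
  have h4 : Real.cos (f z) = 2 * Real.cos (f z / 2) ^ 2 - 1 := by
    rw [← Real.cos_two_mul]; ring_nf
  rw [eq_div_iff hd, h4] at h1
  rw [h3, h4]
  field_simp
  linear_combination Real.sin (f z / 2) * h1

/-- The band edge solution `cos (f / 2)` of the Lamé equation. -/
lemma lame_cos (hf : IsWave c E f) (hd : c ^ 2 - 1 ≠ 0) :
    ∃ V V' : ℝ → ℝ, (∀ z, HasDerivAt V (V' z) z) ∧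
      (∀ z, HasDerivAt V' (-((Real.cos (f z) + (E - 2) / 2) / (c ^ 2 - 1) * V z)) z) ∧
      V = fun z => Real.cos (f z / 2) := by
  refine ⟨fun z => Real.cos (f z / 2), fun z => -Real.sin (f z / 2) * (deriv f z / 2),
    fun z => ((hf.hasDerivAt z).div_const 2).cos, fun z => ?_, rfl⟩
  convert! (((hf.hasDerivAt z).div_const 2).sin.neg).mul
    ((hf.hasDerivAt_deriv hd z).div_const 2) using 1
  have h1 := hf.deriv_sq hd z
  have h2 := Real.sin_sq_add_cos_sq (f z / 2)
  have h3 : Real.sin (f z) = 2 * Real.sin (f z / 2) * Real.cos (f z / 2) := by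
    rw [← Real.sin_two_mul]; ring_nf
  have h4 : Real.cos (f z) = 2 * Real.cos (f z / 2) ^ 2 - 1 := by
    rw [← Real.cos_two_mul]; ring_nf
  rw [eq_div_iff hd, h4] at h1
  rw [h3, h4]
  simp only [Pi.neg_apply]
  field_simp
  linear_combination Real.cos (f z / 2) * h1 - 4 * Real.cos (f z / 2) * h2

/-- Nontriviality of the band edge solution: sin(f/2) ≡ 0 would force f' = 0, whereas the energy
gives df'² = 2E ≠ 0. -/
lemma exists_sin_ne_zero (hf : IsWave c E f) (hE : E ≠ 0) : ∃ z, Real.sin (f z / 2) ≠ 0 := by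
  by_contra! h
  have hcos : ∀ z, Real.cos (f z) = 1 := fun z => by
    have h1 := Real.cos_sq' (f z / 2)
    rw [h z] at h1
    have h2 := Real.cos_two_mul (f z / 2)
    rw [h1, show 2 * (f z / 2) = f z by ring] at h2
    linarith
  have hsq : ∀ z, (c ^ 2 - 1) * deriv f z ^ 2 = 2 * E := fun z => by
    have := hf.energy z
    rw [hcos] at this
    linarith
  have hne : ∀ z, deriv f z ≠ 0 := fun z h0 => by
    have := hsq z
    rw [h0] at this
    exact hE (by linarith)
  have hd := ((hf.hasDerivAt 0).div_const 2).sin.unique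
    ((hasDerivAt_const (0 : ℝ) (0 : ℝ)).congr_of_eventuallyEq (Filter.Eventually.of_forall h))
  rcases mul_eq_zero.1 hd with h0 | h0
  · have := Real.sin_sq_add_cos_sq (f 0 / 2)
    rw [h0, h 0] at this
    norm_num at this
  · exact hne 0 (by linarith)

lemma exists_cos_ne_zero (hf : IsWave c E f) (hE : E ≠ 2) : ∃ z, Real.cos (f z / 2) ≠ 0 := by
  by_contra! h
  have hcos : ∀ z, Real.cos (f z) = -1 := fun z => by
    have h2 := Real.cos_two_mul (f z / 2)
    rw [h z, show 2 * (f z / 2) = f z by ring] at h2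
    linarith
  have hne : ∀ z, deriv f z ≠ 0 := fun z h0 => by
    have := hf.energy z
    rw [hcos, h0] at this
    exact hE (by linarith)
  have hd := ((hf.hasDerivAt 0).div_const 2).cos.unique
    ((hasDerivAt_const (0 : ℝ) (0 : ℝ)).congr_of_eventuallyEq (Filter.Eventually.of_forall h))
  rcases mul_eq_zero.1 hd with h0 | h0
  · have := Real.sin_sq_add_cos_sq (f 0 / 2)
    rw [neg_eq_zero.1 h0, h 0] at this
    norm_num at this
  · exact hne 0 (by linarith)

/-- Both rays belong to the stability spectrum. -/
theorem imaginaryRays_subset (hf : IsWave c E f) (h : Admissible c E) :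
    imaginaryRays c E ⊆ stabilitySpectrum c f := by
  rintro μ ⟨t, ht, rfl⟩
  obtain ⟨hl2, hl0⟩ := h.lambdaOneIm_sq
  have hd := h.sq_sub_one_ne_zero
  have ht2 : lambdaOneIm c E ^ 2 ≤ t ^ 2 := by
    rcases ht with ht | ht <;> nlinarith
  have hc := hf.contDiff.continuous
  suffices ∃ V V' : ℝ → ℂ, (∀ z, HasDerivAt V (V' z) z) ∧
      (∀ z, HasDerivAt V'
        (-(((Real.cos (f z) + t ^ 2 / (c ^ 2 - 1)) / (c ^ 2 - 1) : ℝ) * V z)) z) ∧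
      (∃ z, V z ≠ 0) ∧ ∃ M : ℝ, ∀ z, ‖V z‖ ≤ M by
    obtain ⟨V, V', h1, h2, h3, h4⟩ := this
    exact mem_stabilitySpectrum_of_lame hd hc h1 h2 h3 h4
  set τ := t ^ 2 / (c ^ 2 - 1) with hτ
  have hτd : τ * (c ^ 2 - 1) = t ^ 2 := div_mul_cancel₀ _ hd
  have hτ0 : 0 ≤ τ / (c ^ 2 - 1) := by
    rw [hτ, div_div, ← sq]
    positivity
  -- Dividing t² ≥ |λ₁|² by d gives τ ≤ (E - 2)/2 for d < 0 and τ ≥ E/2 for d > 0. Equality is the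
  -- band edge, where |E - 1 - 2τ| = 1 no longer ensures G > 0; strict inequality gives |E - 1 - 2τ|
  -- > 1, so a suitable sign makes G positive.
  rcases lt_or_gt_of_ne hd with hneg | hpos
  · rw [abs_of_neg hneg] at hl2
    have hE : E ≠ 2 := by
      rintro rfl
      nlinarith [pow_pos hl0 2]
    have hτE : τ ≤ (E - 2) / 2 := by
      by_contra! h1
      nlinarith
    rcases eq_or_lt_of_le hτE with heq | hlt
    · obtain ⟨V, V', h1, h2, h3⟩ := hf.lame_cos hd
      obtain ⟨z, hz⟩ := hf.exists_cos_ne_zero hE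
      refine ⟨fun z => V z, fun z => V' z, fun z => (h1 z).ofReal_comp, fun z => ?_,
        ⟨z, ofReal_ne_zero.2 (by rw [h3]; exact hz)⟩, 1, fun z => ?_⟩
      · rw [heq]
        simpa only [ofReal_neg, ofReal_mul] using (h2 z).ofReal_comp
      · rw [h3, norm_real]
        exact Real.abs_cos_le_one _
    · have hq : 1 < E - 1 - 2 * τ := by linarith
      obtain ⟨V, V', h1, h2, h3, h4⟩ := hf.lame_of_pos hd (σ := 1) (τ := τ) (by norm_num)
        (fun z => by linarith [Real.neg_one_le_cos (f z)]) (mul_nonneg hτ0 (by nlinarith))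
      exact ⟨V, V', h1, h2, ⟨0, h3⟩, h4⟩
  · rw [abs_of_pos hpos] at hl2
    have hE : E ≠ 0 := by
      rintro rfl
      nlinarith [pow_pos hl0 2]
    have hτE : E / 2 ≤ τ := by
      by_contra! h1
      nlinarith
    rcases eq_or_lt_of_le hτE with heq | hlt
    · obtain ⟨V, V', h1, h2, h3⟩ := hf.lame_sin hd
      obtain ⟨z, hz⟩ := hf.exists_sin_ne_zero hE
      refine ⟨fun z => V z, fun z => V' z, fun z => (h1 z).ofReal_comp, fun z => ?_,
        ⟨z, ofReal_ne_zero.2 (by rw [h3]; exact hz)⟩, 1, fun z => ?_⟩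
      · rw [← heq]
        simpa only [ofReal_neg, ofReal_mul] using (h2 z).ofReal_comp
      · rw [h3, norm_real]
        exact Real.abs_sin_le_one _
    · have hq : E - 1 - 2 * τ < -1 := by linarith
      obtain ⟨V, V', h1, h2, h3, h4⟩ := hf.lame_of_pos hd (σ := -1) (τ := τ) (by norm_num)
        (fun z => by linarith [Real.cos_le_one (f z)]) (mul_nonneg hτ0 (by nlinarith))
      exact ⟨V, V', h1, h2, ⟨0, h3⟩, h4⟩

end IsWave

end SineGordon

theorem mainTheorem4 (c E : ℝ) (h : SineGordon.Admissible c E) :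
    (∀ ζ : ℝ, ζ ≠ 0 → ∀ Ω : ℂ, Ω ^ 2 = SineGordon.omegaSq c E ζ →
      Ω.re = 0 ∧
      (∃ ρ : ℂ, SineGordon.IsRho h ζ Ω ρ) ∧
      (∀ ρ : ℂ, SineGordon.IsRho h ζ Ω ρ → (SineGordon.laxI h ζ Ω ρ).re = 0) ∧
      (0 < (c + 1) * ζ * Ω.im → ∃ ρ : ℂ, SineGordon.IsRho h ζ Ω ρ ∧ ρ.re = 0 ∧
        (SineGordon.weierstrassZeta (SineGordon.waveLattice h) ρ).re = 0)) ∧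
    {μ : ℂ | ∃ ζ : ℝ, ζ ≠ 0 ∧ ∃ Ω : ℂ, Ω ^ 2 = SineGordon.omegaSq c E ζ ∧ μ = 2 * Ω} =
      SineGordon.imaginaryRays c E ∧
    (∀ f : ℝ → ℝ, SineGordon.IsWave c E f →
      (∀ ζ : ℝ, ζ ≠ 0 → (ζ : ℂ) ∈ SineGordon.laxSpectrum c f) ∧
      (∀ ζ : ℝ, ζ ≠ 0 → ∀ Ω : ℂ, Ω ^ 2 = SineGordon.omegaSq c E ζ →
        2 * Ω ∈ SineGordon.stabilitySpectrum c f) ∧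
      SineGordon.imaginaryRays c E ⊆ SineGordon.stabilitySpectrum c f) := by
  refine ⟨fun ζ hζ Ω hΩ => h.lax_condition hζ hΩ, h.omega_values, fun f hf =>
    ⟨fun ζ hζ => hf.mem_laxSpectrum hζ, fun ζ hζ Ω hΩ => hf.imaginaryRays_subset h ?_,
      hf.imaginaryRays_subset h⟩⟩
  rw [← h.omega_values]
  exact ⟨ζ, hζ, Ω, hΩ, rfl⟩
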